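/- \textbf{Gauge-invariant uniqueness theorem.} Let $k\ge 0$ and let $\Lambda$ be a row-finite $k$-graph with no sources: $\Lambda$ is a nonempty countable small category with a functor $d:\Lambda\to\mathbb N^k$ (the degree) such that whenever $d(\lambda)=m+n$ there are unique $\mu,\nu\in\Lambda$ with $d(\mu)=m$, $d(\nu)=n$ and $\lambda=\mu\nu$; and, writing $r(\lambda)$, $s(\lambda)$ for the codomain and domain of $\lambda$, identifying the objects with the set $\Lambda^0=d^{-1}(0)$ of identity morphisms, and putting $v\Lambda^n=\{\lambda: d(\lambda)=n,\ r(\lambda)=v\}$, each set $v\Lambda^n$ ($v\in\Lambda^0$, $n\in\mathbb N^k$) is finite and nonempty. Let $c$ be a $\mathbb T$-valued categorical $2$-cocycle on $\Lambda$, that is, a function assigning $c(\mu,\nu)\in\mathbb T$ to each pair $(\mu,\nu)$ with $s(\mu)=r(\nu)$, such that $c(\mu,\nu)=1$ if $\mu\in\Lambda^0$ or $\nu\in\Lambda^0$, and \[ c(\lambda_1,\lambda_2)\,c(\lambda_1\lambda_2,\lambda_3)=c(\lambda_2,\lambda_3)\,c(\lambda_1,\lambda_2\lambda_3) \] for all composable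 triples. A Cuntz--Krieger $(\Lambda,c)$-family in a $C^*$-algebra $B$ is a function $t:\Lambda\to B$, $\lambda\mapsto t_\lambda$, such that (CK1) $\{t_v: v\in\Lambda^0\}$ are mutually orthogonal projections; (CK2) $t_\mu t_\nu=c(\mu,\nu)t_{\mu\nu}$ whenever $s(\mu)=r(\nu)$; (CK3) $t_\lambda^*t_\lambda=t_{s(\lambda)}$ for all $\lambda\in\Lambda$; (CK4) $t_v=\sum_{\lambda\in v\Lambda^n}t_\lambda t_\lambda^*$ for all $v\in\Lambda^0$ and $n\in\mathbb N^k$. Let $C^*(\Lambda,c)$ be the universal $C^*$-algebra generated by a Cuntz--Krieger $(\Lambda,c)$-family $s$; thus each Cuntz--Krieger $(\Lambda,c)$-family $t$ in a $C^*$-algebra $B$ induces a unique $*$-homomorphism $\pi_t:C^*(\Lambda,c)\to B$ with $\pi_t(s_\lambda)=t_\lambda$ for all $\lambda\in\Lambda$. Let $t$ be a Cuntz--Krieger $(\Lambda,c)$-family in a $C^*$-algebra $B$, and suppose that there is a strongly continuous action $\beta$ of $\mathbb T^k$ on $B$ by $*$-automorphisms (that is, $z\mapsto\beta_z(b)$ is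 continuous for each $b\in B$) such that $\beta_z(t_\lambda)=z^{d(\lambda)}t_\lambda$ for all $\lambda\in\Lambda$ and $z\in\mathbb T^k$, where $z^{n}=\prod_{i=1}^k z_i^{n_i}$. Then $\pi_t:C^*(\Lambda,c)\to B$ is injective if and only if $t_v\neq 0$ for all $v\in\Lambda^0$. -/

import Mathlib

open CategoryTheory

namespace TwistedKGraph

universe u v w

/-! ### Higher-rank graphs and cocycles

For a morphism `f : x ⟶ y` the source of the path `f` is `x` and its range is `y`; the composite path
written `μν` (defined when `s(μ) = r(ν)`) is `ν ≫ μ`. Vertices are identified with objects. -/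

/-- A `k`-graph: a nonempty countable small category with a degree functor to `ℕ^k` that has
the factorisation property. -/
structure KGraph (k : ℕ) (Λ : Type u) [Category.{v} Λ] where
  nonempty : Nonempty Λ
  countable_obj : Countable Λ
  countable_hom : ∀ x y : Λ, Countable (x ⟶ y)
  /-- the degree functor -/
  deg : ∀ {x y : Λ}, (x ⟶ y) → (Fin k → ℕ)
  deg_id : ∀ x : Λ, deg (𝟙 x) = 0
  deg_comp : ∀ {x y z : Λ} (μ : y ⟶ z) (ν : x ⟶ y), deg (ν ≫ μ) = deg μ + deg ν
  factorisation : ∀ {x y : Λ} (f : x ⟶ y) (m n : Fin k → ℕ), deg f = m + n →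
    ∃! p : Σ z : Λ, (z ⟶ y) × (x ⟶ z),
      deg p.2.1 = m ∧ deg p.2.2 = n ∧ p.2.2 ≫ p.2.1 = f

/-- The set `vΛ^n` of paths of degree `n` with range `v`. -/
def KGraph.pathsInto {k : ℕ} {Λ : Type u} [Category.{v} Λ] (G : KGraph k Λ) (y : Λ)
    (n : Fin k → ℕ) : Set (Σ x : Λ, x ⟶ y) :=
  {p | G.deg p.2 = n}

/-- Every `vΛ^n` is finite. -/
def KGraph.RowFinite {k : ℕ} {Λ : Type u} [Category.{v} Λ] (G : KGraph k Λ) : Prop :=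
  ∀ (y : Λ) (n : Fin k → ℕ), (G.pathsInto y n).Finite

/-- Every `vΛ^n` is nonempty. -/
def KGraph.NoSources {k : ℕ} {Λ : Type u} [Category.{v} Λ] (G : KGraph k Λ) : Prop :=
  ∀ (y : Λ) (n : Fin k → ℕ), (G.pathsInto y n).Nonempty

/-- A (normalised) `𝕋`-valued categorical `2`-cocycle on a category; `c μ ν` is defined for
composable pairs `(μ, ν)`, that is `s(μ) = r(ν)`. -/
structure TwoCocycle (Λ : Type u) [Category.{v} Λ] where
  toFun : ∀ {x y z : Λ}, (y ⟶ z) → (x ⟶ y) → Circle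
  map_id_left : ∀ {x y : Λ} (f : x ⟶ y), toFun (𝟙 y) f = 1
  map_id_right : ∀ {x y : Λ} (f : x ⟶ y), toFun f (𝟙 x) = 1
  cocycle : ∀ {w x y z : Λ} (f : y ⟶ z) (g : x ⟶ y) (h : w ⟶ x),
    toFun f g * toFun (g ≫ f) h = toFun g h * toFun f (h ≫ g)

/-! ### Cuntz-Krieger families -/

/-- A Cuntz-Krieger `(Λ, c)`-family in a `C*`-algebra `B`. In `ck4` the finite set `F` is `vΛ^n`
(it exists and is unique when `Λ` is row-finite). -/
structure IsCKFamily {k : ℕ} {Λ : Type u} [Category.{v} Λ] (G : KGraph k Λ) (c : TwoCocycle Λ)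
    {B : Type w} [NonUnitalCStarAlgebra B] (t : ∀ ⦃x y : Λ⦄, (x ⟶ y) → B) : Prop where
  ck1_proj : ∀ x : Λ, IsStarProjection (t (𝟙 x))
  ck1_orth : ∀ x y : Λ, x ≠ y → t (𝟙 x) * t (𝟙 y) = 0
  ck2 : ∀ ⦃x y z : Λ⦄ (μ : y ⟶ z) (ν : x ⟶ y),
    t μ * t ν = (c.toFun μ ν : ℂ) • t (ν ≫ μ)
  ck3 : ∀ ⦃x y : Λ⦄ (f : x ⟶ y), star (t f) * t f = t (𝟙 x)
  ck4 : ∀ (y : Λ) (n : Fin k → ℕ) (F : Finset (Σ x : Λ, x ⟶ y)),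
    (F : Set (Σ x : Λ, x ⟶ y)) = G.pathsInto y n → t (𝟙 y) = ∑ p ∈ F, t p.2 * star (t p.2)

/-! ### The free `*`-algebra on a set -/

/-- The free (non-unital) complex `*`-algebra on a set `X`: the semigroup algebra of the free
semigroup on the symbols `x = (x, false)` and `x^* = (x, true)`. -/
abbrev FreeStar (X : Type u) : Type u := MonoidAlgebra ℂ (FreeSemigroup (X × Bool))

namespace FreeStar

variable {X : Type u}

/-- The scalar multiple `z • w` of a word `w`. -/
noncomputable def mono (w : FreeSemigroup (X × Bool)) (z : ℂ) : FreeStar X :=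
  MonoidAlgebra.single w z

/-- The generator attached to `x`. -/
noncomputable def of (x : X) : FreeStar X := mono (FreeSemigroup.of (x, false)) 1

theorem mono_mul (w w' : FreeSemigroup (X × Bool)) (z z' : ℂ) :
    mono w z * mono w' z' = mono (w * w') (z * z') :=
  MonoidAlgebra.single_mul_single w w' z z'

theorem smul_mono (a : ℂ) (w : FreeSemigroup (X × Bool)) (z : ℂ) :
    a • mono w z = mono w (a * z) := by
  simp [mono]

theorem mono_add (w : FreeSemigroup (X × Bool)) (z z' : ℂ) :
    mono w (z + z') = mono w z + mono w z' := 
  MonoidAlgebra.single_add ..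

theorem induction {P : FreeStar X → Prop} (a : FreeStar X) (h0 : P 0)
    (hadd : ∀ a b, P a → P b → P (a + b)) (hm : ∀ w z, P (mono w z)) : P a :=
  MonoidAlgebra.induction_linear a h0 hadd hm

/-- Reversal of words, exchanging `x` and `x^*`. -/
def wordStarHom : FreeSemigroup (X × Bool) →ₙ* (FreeSemigroup (X × Bool))ᵐᵒᵖ :=
  FreeSemigroup.lift fun p => MulOpposite.op (FreeSemigroup.of (p.1, !p.2))

/-- Reversal of words, exchanging `x` and `x^*`. -/
def wordStar (w : FreeSemigroup (X × Bool)) : FreeSemigroup (X × Bool) :=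
  (wordStarHom w).unop

theorem wordStar_of (p : X × Bool) :
    wordStar (FreeSemigroup.of p) = FreeSemigroup.of (p.1, !p.2) := rfl

theorem wordStar_mul (w w' : FreeSemigroup (X × Bool)) :
    wordStar (w * w') = wordStar w' * wordStar w := by
  simp [wordStar]

theorem wordStar_wordStar (w : FreeSemigroup (X × Bool)) : wordStar (wordStar w) = w := by
  induction w using FreeSemigroup.recOnMul with
  | ih1 p => simp [wordStar_of]
  | ih2 p w _ hw => rw [wordStar_mul, wordStar_mul, hw, wordStar_of, wordStar_of]; simp

/-- The involution, as an additive map. -/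
noncomputable def starHom : FreeStar X →+ FreeStar X :=
  (Finsupp.liftAddHom fun w : FreeSemigroup (X × Bool) =>
    (MonoidAlgebra.singleAddHom (wordStar w)).comp
      (starAddEquiv : ℂ ≃+ ℂ).toAddMonoidHom).comp
    (MonoidAlgebra.coeffAddEquiv
      (R := ℂ) (M := FreeSemigroup (X × Bool))).toAddMonoidHom

theorem starHom_mono (w : FreeSemigroup (X × Bool)) (z : ℂ) :
    starHom (mono w z) = mono (wordStar w) (star z) := by
  simp [starHom, mono]

noncomputable instance : StarRing (FreeStar X) where
  star := starHom
  star_involutive a := by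
    induction a using FreeStar.induction with
    | h0 => simp
    | hadd a b ha hb => rw [map_add, map_add, ha, hb]
    | hm w z => simp [starHom_mono, wordStar_wordStar]
  star_mul a b := by
    induction a using FreeStar.induction with
    | h0 => simp
    | hadd a a' ha ha' => rw [add_mul, map_add, map_add, ha, ha', mul_add]
    | hm w z =>
      induction b using FreeStar.induction with
      | h0 => simp
      | hadd b b' hb hb' => rw [mul_add, map_add, map_add, hb, hb', add_mul]
      | hm w' z' => simp [starHom_mono, mono_mul, wordStar_mul, mul_comm]
  star_add := map_add starHom

theorem star_mono (w : FreeSemigroup (X × Bool)) (z : ℂ) :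
    star (mono w z) = mono (wordStar w) (star z) := starHom_mono w z

instance : StarModule ℂ (FreeStar X) where
  star_smul z a := by
    induction a using FreeStar.induction with
    | h0 => simp
    | hadd a b ha hb => rw [smul_add, star_add, star_add, ha, hb, smul_add]
    | hm w z' => simp [star_mono, smul_mono]

section lift

variable {B : Type w} [NonUnitalCStarAlgebra B]

/-- The value of a word under a map of the generators into a `C*`-algebra. -/
noncomputable def wordLift (t : X → B) : FreeSemigroup (X × Bool) →ₙ* B :=
  FreeSemigroup.lift fun p => if p.2 then star (t p.1) else t p.1

theorem wordLift_wordStar (t : X → B) (w : FreeSemigroup (X × Bool)) :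
    wordLift t (wordStar w) = star (wordLift t w) := by
  induction w using FreeSemigroup.recOnMul with
  | ih1 p => rcases p with ⟨x, b⟩; cases b <;> simp [wordStar_of, wordLift]
  | ih2 p w hp hw => rw [wordStar_mul, map_mul, map_mul, hw, hp, star_mul]

/-- The `*`-homomorphism on the free `*`-algebra determined by its values on the generators. -/
noncomputable def lift (t : X → B) : FreeStar X →⋆ₙₐ[ℂ] B where
  toNonUnitalAlgHom := MonoidAlgebra.liftMagma ℂ (wordLift t)
  map_star' a := by
    change MonoidAlgebra.liftMagma ℂ (wordLift t) (star a) =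
      star (MonoidAlgebra.liftMagma ℂ (wordLift t) a)
    induction a using FreeStar.induction with
    | h0 => simp only [star_zero, map_zero]
    | hadd a b ha hb => rw [star_add, map_add, map_add, ha, hb, star_add]
    | hm w z => rw [star_mono]; simp [mono, wordLift_wordStar]

theorem lift_mono (t : X → B) (w : FreeSemigroup (X × Bool)) (z : ℂ) :
    lift t (mono w z) = z • wordLift t w := by
  change MonoidAlgebra.liftMagma ℂ (wordLift t) (mono w z) = _
  simp [mono]

theorem lift_of (t : X → B) (x : X) : lift t (of x) = t x := by
  simp [of, lift_mono, wordLift]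

end lift

end FreeStar

/-! ### The enveloping `C*`-algebra of a `*`-algebra with a `C*`-seminorm -/

/-- The seminorm of a seminormed `*`-algebra satisfies the `C*`-inequality. -/
class PreCStar (A : Type u) [NonUnitalSeminormedRing A] [StarRing A] : Prop where
  norm_mul_self_le : ∀ a : A, ‖a‖ * ‖a‖ ≤ ‖star a * a‖

/-- The Hausdorff completion of a seminormed `*`-algebra. -/
abbrev CStarCompletion (A : Type u) [NonUnitalSeminormedRing A] : Type u :=
  UniformSpace.Completion A

namespace CStarCompletion

open UniformSpace UniformSpace.Completion

variable {A : Type u} [NonUnitalSeminormedRing A]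

/-- The continuous extension of the multiplication. -/
noncomputable instance : Mul (CStarCompletion A) :=
  ⟨Function.curry <| (isDenseInducing_coe.prodMap isDenseInducing_coe).extend
    ((↑) ∘ Function.uncurry (· * ·))⟩

theorem coe_mul (a b : A) : ((a * b : A) : CStarCompletion A) = a * b :=
  ((isDenseInducing_coe.prodMap isDenseInducing_coe).extend_eq
      ((continuous_coe A).comp (@continuous_mul A _ _ _)) (a, b)).symm

instance : ContinuousMul (CStarCompletion A) where
  continuous_mul := by
    let m := (AddMonoidHom.mul : A →+ A →+ A).compr₂ toCompl
    have : Continuous fun p : A × A => m p.1 p.2 := (continuous_coe A).comp continuous_mul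
    have di : IsDenseInducing (toCompl : A → Completion A) := isDenseInducing_coe
    exact (di.extend_Z_bilin di this :)

section towers

variable [NormedSpace ℂ A]

theorem continuous_smul' (z : ℂ) : Continuous fun a : CStarCompletion A => z • a :=
  (uniformContinuous_const_smul z).continuous

instance [IsScalarTower ℂ A A] : IsScalarTower ℂ (CStarCompletion A) (CStarCompletion A) where
  smul_assoc z a b := by
    simp only [smul_eq_mul]
    refine Completion.induction_on₂ a b (isClosed_eq
      (((continuous_smul' z).comp continuous_fst).mul continuous_snd)
      ((continuous_smul' z).comp (continuous_fst.mul continuous_snd))) fun a b => ?_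
    rw [← coe_smul, ← coe_mul, ← coe_mul, ← coe_smul, smul_mul_assoc]

instance [SMulCommClass ℂ A A] : SMulCommClass ℂ (CStarCompletion A) (CStarCompletion A) where
  smul_comm z a b := by
    simp only [smul_eq_mul]
    refine Completion.induction_on₂ a b (isClosed_eq
      ((continuous_smul' z).comp (continuous_fst.mul continuous_snd))
      (continuous_fst.mul ((continuous_smul' z).comp continuous_snd))) fun a b => ?_
    rw [← coe_smul, ← coe_mul, ← coe_mul, ← coe_smul, mul_smul_comm]

end towers

section star

variable [StarRing A] [PreCStar A]

theorem norm_le_norm_star (a : A) : ‖a‖ ≤ ‖star a‖ := by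
  rcases (norm_nonneg a).eq_or_lt' with h | h
  · rw [h]; exact norm_nonneg _
  · exact le_of_mul_le_mul_right ((PreCStar.norm_mul_self_le a).trans (norm_mul_le _ _)) h

theorem norm_star_eq (a : A) : ‖star a‖ = ‖a‖ :=
  le_antisymm (by simpa using norm_le_norm_star (star a)) (norm_le_norm_star a)

theorem continuous_star_pre : Continuous (starAddEquiv : A ≃+ A).toAddMonoidHom :=
  (AddMonoidHomClass.isometry_of_norm (starAddEquiv : A ≃+ A) norm_star_eq).continuous

/-- The continuous extension of the involution, as an additive map. -/
noncomputable def starHom : CStarCompletion A →+ CStarCompletion A :=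
  (starAddEquiv : A ≃+ A).toAddMonoidHom.completion continuous_star_pre

theorem starHom_coe (a : A) : starHom (a : CStarCompletion A) = (star a : A) :=
  AddMonoidHom.completion_coe _ continuous_star_pre a

theorem continuous_starHom : Continuous (starHom : CStarCompletion A → CStarCompletion A) :=
  AddMonoidHom.continuous_completion _ continuous_star_pre

noncomputable instance : Star (CStarCompletion A) := ⟨starHom⟩

theorem star_coe (a : A) : star (a : CStarCompletion A) = (star a : A) := starHom_coe a

theorem continuous_star' : Continuous (star : CStarCompletion A → CStarCompletion A) :=
  continuous_starHom

instance [NormedSpace ℂ A] [StarModule ℂ A] : StarModule ℂ (CStarCompletion A) where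
  star_smul z a := by
    refine Completion.induction_on a (isClosed_eq
      (continuous_star'.comp (continuous_smul' z))
      ((continuous_smul' (star z)).comp continuous_star')) fun a => ?_
    rw [← coe_smul, star_coe, star_coe, ← coe_smul, star_smul]

end star

noncomputable instance : NonUnitalNormedRing (CStarCompletion A) where
  __ : NormedAddCommGroup (Completion A) := inferInstance
  __ : Mul (Completion A) := inferInstance
  zero_mul a := by
    refine Completion.induction_on a (isClosed_eq (by fun_prop) (by fun_prop)) fun a => ?_
    rw [← coe_zero, ← coe_mul, zero_mul]
  mul_zero a := by
    refine Completion.induction_on a (isClosed_eq (by fun_prop) (by fun_prop)) fun a => ?_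
    rw [← coe_zero, ← coe_mul, mul_zero]
  mul_assoc a b c := by
    refine Completion.induction_on₃ a b c (isClosed_eq (by fun_prop) (by fun_prop))
      fun a b c => ?_
    rw [← coe_mul, ← coe_mul, ← coe_mul, ← coe_mul, mul_assoc]
  left_distrib a b c := by
    refine Completion.induction_on₃ a b c (isClosed_eq (by fun_prop) (by fun_prop))
      fun a b c => ?_
    rw [← coe_add, ← coe_mul, ← coe_mul, ← coe_mul, ← coe_add, mul_add]
  right_distrib a b c := by
    refine Completion.induction_on₃ a b c (isClosed_eq (by fun_prop) (by fun_prop))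
      fun a b c => ?_
    rw [← coe_add, ← coe_mul, ← coe_mul, ← coe_mul, ← coe_add, add_mul]
  norm_mul_le a b := by
    refine Completion.induction_on₂ a b (isClosed_le (by fun_prop) (by fun_prop)) fun a b => ?_
    rw [← coe_mul, norm_coe, norm_coe, norm_coe]
    exact norm_mul_le a b

section normedSpace

variable [StarRing A] [PreCStar A]

noncomputable instance : StarRing (CStarCompletion A) where
  star_involutive a := by
    have := continuous_starHom (A := A)
    change starHom (starHom a) = a
    refine Completion.induction_on a (isClosed_eq (by fun_prop) (by fun_prop)) fun a => ?_
    rw [starHom_coe, starHom_coe, star_star]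
  star_mul a b := by
    have := continuous_starHom (A := A)
    change starHom (a * b) = starHom b * starHom a
    refine Completion.induction_on₂ a b (isClosed_eq (by fun_prop) (by fun_prop)) fun a b => ?_
    rw [starHom_coe, starHom_coe, ← coe_mul, starHom_coe, ← coe_mul, star_mul]
  star_add := by
    intro a b
    exact map_add starHom a b

instance : CStarRing (CStarCompletion A) where
  norm_mul_self_le a := by
    have := continuous_star' (A := A)
    refine Completion.induction_on a (isClosed_le (by fun_prop) (by fun_prop)) fun a => ?_
    rw [star_coe, ← coe_mul, norm_coe, norm_coe]
    exact PreCStar.norm_mul_self_le a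

variable [NormedSpace ℂ A] [StarModule ℂ A]
variable [IsScalarTower ℂ A A] [SMulCommClass ℂ A A]

noncomputable instance : NonUnitalCStarAlgebra (CStarCompletion A) where
  __ : NonUnitalNormedRing (CStarCompletion A) := inferInstance
  __ : StarRing (CStarCompletion A) := inferInstance
  __ : CompleteSpace (CStarCompletion A) := inferInstance
  __ : CStarRing (CStarCompletion A) := inferInstance
  __ : NormedSpace ℂ (CStarCompletion A) := inferInstance
  __ : IsScalarTower ℂ (CStarCompletion A) (CStarCompletion A) := inferInstance
  __ : SMulCommClass ℂ (CStarCompletion A) (CStarCompletion A) := inferInstance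
  __ : StarModule ℂ (CStarCompletion A) := inferInstance

variable {B : Type w} [NonUnitalCStarAlgebra B]

/-- A contractive `*`-homomorphism as a continuous linear map. -/
noncomputable def toCLM (φ : A →⋆ₙₐ[ℂ] B) (hφ : ∀ a, ‖φ a‖ ≤ ‖a‖) : A →L[ℂ] B :=
  LinearMap.mkContinuous { toFun := φ, map_add' := map_add φ, map_smul' := map_smul φ } 1
    (by simpa using hφ)

/-- Extension of a contractive `*`-homomorphism to the completion. -/
noncomputable def extend (φ : A →⋆ₙₐ[ℂ] B) (hφ : ∀ a, ‖φ a‖ ≤ ‖a‖) :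
    CStarCompletion A →⋆ₙₐ[ℂ] B where
  toFun := (toCLM φ hφ).fromCompletion
  map_smul' z a := map_smul _ z a
  map_zero' := map_zero _
  map_add' a b := map_add _ a b
  map_mul' a b := by
    refine Completion.induction_on₂ a b (isClosed_eq (by fun_prop) (by fun_prop)) fun a b => ?_
    rw [← coe_mul]
    simp only [ContinuousLinearMap.fromCompletion_apply_coe]
    exact map_mul φ a b
  map_star' a := by
    have := continuous_star' (A := A)
    refine Completion.induction_on a (isClosed_eq (by fun_prop) (by fun_prop)) fun a => ?_
    rw [star_coe]
    simp only [ContinuousLinearMap.fromCompletion_apply_coe]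
    exact map_star φ a

theorem extend_coe (φ : A →⋆ₙₐ[ℂ] B) (hφ : ∀ a, ‖φ a‖ ≤ ‖a‖) (a : A) :
    extend φ hφ (a : CStarCompletion A) = φ a :=
  ContinuousLinearMap.fromCompletion_apply_coe _ a

/-- The canonical map into the completion, as a `*`-homomorphism. -/
noncomputable def coeHom : A →⋆ₙₐ[ℂ] CStarCompletion A where
  toFun a := a
  map_smul' z a := coe_smul z a
  map_zero' := coe_zero
  map_add' a b := coe_add a b
  map_mul' a b := coe_mul a b
  map_star' a := (star_coe a).symm

end normedSpace

end CStarCompletion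

/-! ### The twisted `C*`-algebra `C*(Λ, c)` -/

section twisted

variable {k : ℕ} {Λ : Type u} [Category.{v} Λ]

/-- The set of all morphisms (paths) of `Λ`. -/
abbrev Mor (Λ : Type u) [Category.{v} Λ] : Type (max u v) := Σ x y : Λ, x ⟶ y

/-- The generator of the free `*`-algebra attached to a path. -/
noncomputable def gen {x y : Λ} (f : x ⟶ y) : FreeStar (Mor Λ) := FreeStar.of ⟨x, y, f⟩

/-- The Cuntz-Krieger relations in the free `*`-algebra on the paths of `Λ`. -/
inductive Rel (G : KGraph k Λ) (c : TwoCocycle Λ) : FreeStar (Mor Λ) → FreeStar (Mor Λ) → Prop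
  | ck1_mul (x : Λ) : Rel G c (gen (𝟙 x) * gen (𝟙 x)) (gen (𝟙 x))
  | ck1_star (x : Λ) : Rel G c (star (gen (𝟙 x))) (gen (𝟙 x))
  | ck1_orth (x y : Λ) (h : x ≠ y) : Rel G c (gen (𝟙 x) * gen (𝟙 y)) 0
  | ck2 {x y z : Λ} (μ : y ⟶ z) (ν : x ⟶ y) :
      Rel G c (gen μ * gen ν) ((c.toFun μ ν : ℂ) • gen (ν ≫ μ))
  | ck3 {x y : Λ} (f : x ⟶ y) : Rel G c (star (gen f) * gen f) (gen (𝟙 x))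
  | ck4 (y : Λ) (n : Fin k → ℕ) (F : Finset (Σ x : Λ, x ⟶ y))
      (hF : (F : Set (Σ x : Λ, x ⟶ y)) = G.pathsInto y n) :
      Rel G c (gen (𝟙 y)) (∑ p ∈ F, gen p.2 * star (gen p.2))

/-- A `C*`-seminorm on the free `*`-algebra in which the Cuntz-Krieger relations hold. These are
exactly the seminorms `a ↦ ‖φ a‖` for `*`-homomorphisms `φ` into `C*`-algebras that carry the
generators to a Cuntz-Krieger family. -/
structure IsCKSeminorm (G : KGraph k Λ) (c : TwoCocycle Λ) (p : Seminorm ℂ (FreeStar (Mor Λ))) :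
    Prop where
  mul_le : ∀ a b, p (a * b) ≤ p a * p b
  star_mul_self : ∀ a, p (star a * a) = p a * p a
  rel : ∀ a b, Rel G c a b → p (a - b) = 0

variable (G : KGraph k Λ) (c : TwoCocycle Λ)

theorem isCKSeminorm_zero : IsCKSeminorm G c 0 where
  mul_le := by simp
  star_mul_self := by simp
  rel := by simp

variable {G c}

namespace IsCKSeminorm

variable {p : Seminorm ℂ (FreeStar (Mor Λ))}

theorem eq_of_rel (hp : IsCKSeminorm G c p) {a b : FreeStar (Mor Λ)} (h : Rel G c a b) : p a = p b := by
  have h0 := hp.rel a b h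
  have h1 : p a ≤ p (a - b) + p b := by simpa using map_add_le_add p (a - b) b
  have h2 : p b ≤ p (b - a) + p a := by simpa using map_add_le_add p (b - a) a
  rw [map_sub_rev] at h2
  linarith

theorem star_eq (hp : IsCKSeminorm G c p) (a : FreeStar (Mor Λ)) : p (star a) = p a := by
  have key : ∀ a, p a ≤ p (star a) := fun a => by
    rcases (apply_nonneg p a).eq_or_lt' with h | h
    · rw [h]; exact apply_nonneg p _
    · exact le_of_mul_le_mul_right ((hp.star_mul_self a).symm.trans_le (hp.mul_le _ _)) h
  exact le_antisymm (by simpa using key (star a)) (key a)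

theorem gen_le_one (hp : IsCKSeminorm G c p) {x y : Λ} (f : x ⟶ y) : p (gen f) ≤ 1 := by
  have h1 : p (gen (𝟙 x)) ≤ 1 := by
    have h := hp.star_mul_self (gen (𝟙 x))
    rw [hp.eq_of_rel (Rel.ck3 (𝟙 x))] at h
    nlinarith [apply_nonneg p (gen (𝟙 x))]
  have h := hp.star_mul_self (gen f)
  rw [hp.eq_of_rel (Rel.ck3 f)] at h
  nlinarith [apply_nonneg p (gen f)]

theorem letter_le_one (hp : IsCKSeminorm G c p) (q : Mor Λ × Bool) : p (FreeStar.mono (FreeSemigroup.of q) 1) ≤ 1 := by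
  obtain ⟨⟨x, y, f⟩, b⟩ := q
  have h := hp.gen_le_one f
  cases b
  · exact h
  · rw [← hp.star_eq, FreeStar.star_mono]
    simpa [FreeStar.wordStar_of, gen, FreeStar.of] using h

theorem word_le_one (hp : IsCKSeminorm G c p) (w : FreeSemigroup (Mor Λ × Bool)) : p (FreeStar.mono w 1) ≤ 1 := by
  induction w using FreeSemigroup.recOnMul with
  | ih1 q => exact hp.letter_le_one q
  | ih2 q w hq hw =>
    have : FreeStar.mono (FreeSemigroup.of q * w) 1 =
        FreeStar.mono (FreeSemigroup.of q) 1 * FreeStar.mono w 1 := by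
      rw [FreeStar.mono_mul, mul_one]
    rw [this]
    exact (hp.mul_le _ _).trans (mul_le_one₀ hq (apply_nonneg p _) hw)

end IsCKSeminorm

theorem exists_bound (a : FreeStar (Mor Λ)) :
    ∃ C, ∀ p : Seminorm ℂ (FreeStar (Mor Λ)), IsCKSeminorm G c p → p a ≤ C := by
  induction a using FreeStar.induction with
  | h0 => exact ⟨0, fun p _ => by simp⟩
  | hadd a b ha hb =>
    obtain ⟨C, hC⟩ := ha
    obtain ⟨D, hD⟩ := hb
    exact ⟨C + D, fun p hp => (map_add_le_add p a b).trans (add_le_add (hC p hp) (hD p hp))⟩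
  | hm w z =>
    refine ⟨‖z‖, fun p hp => ?_⟩
    have : FreeStar.mono w z = z • FreeStar.mono w 1 := by rw [FreeStar.smul_mono, mul_one]
    rw [this, map_smul_eq_mul]
    exact mul_le_of_le_one_right (norm_nonneg z) (hp.word_le_one w)

variable (G c)

/-- The index set of all `C*`-seminorms in which the Cuntz-Krieger relations hold. -/
abbrev CKSeminorm : Type (max u v) := {p : Seminorm ℂ (FreeStar (Mor Λ)) // IsCKSeminorm G c p}

instance : Nonempty (CKSeminorm G c) := ⟨⟨0, isCKSeminorm_zero G c⟩⟩

theorem bddAbove_range (a : FreeStar (Mor Λ)) :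
    BddAbove (Set.range fun p : CKSeminorm G c => p.1 a) := by
  obtain ⟨C, hC⟩ := exists_bound (G := G) (c := c) a
  exact ⟨C, by rintro _ ⟨p, rfl⟩; exact hC p.1 p.2⟩

/-- The universal `C*`-seminorm: the supremum of all `C*`-seminorms in which the Cuntz-Krieger
relations hold. -/
noncomputable def univSeminorm : Seminorm ℂ (FreeStar (Mor Λ)) :=
  Seminorm.of (fun a => ⨆ p : CKSeminorm G c, p.1 a)
    (fun a b => ciSup_le fun p => (map_add_le_add p.1 a b).trans
      (add_le_add (le_ciSup (bddAbove_range G c a) p) (le_ciSup (bddAbove_range G c b) p)))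
    (fun z a => by simp_rw [map_smul_eq_mul]; exact (Real.mul_iSup_of_nonneg (norm_nonneg z) _).symm)

variable {G c} in
theorem le_univSeminorm {p : Seminorm ℂ (FreeStar (Mor Λ))} (hp : IsCKSeminorm G c p)
    (a : FreeStar (Mor Λ)) : p a ≤ univSeminorm G c a :=
  le_ciSup (bddAbove_range G c a) ⟨p, hp⟩

variable {G c} in
theorem univSeminorm_le {a : FreeStar (Mor Λ)} {C : ℝ}
    (h : ∀ p, IsCKSeminorm G c p → p a ≤ C) : univSeminorm G c a ≤ C :=
  ciSup_le fun p : CKSeminorm G c => h p.1 p.2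

theorem isCKSeminorm_univSeminorm : IsCKSeminorm G c (univSeminorm G c) where
  mul_le a b := univSeminorm_le fun p hp => (hp.mul_le a b).trans
    (mul_le_mul (le_univSeminorm hp a) (le_univSeminorm hp b) (apply_nonneg _ _)
      (apply_nonneg _ _))
  star_mul_self a := by
    apply le_antisymm
    · refine univSeminorm_le fun p hp => ?_
      rw [hp.star_mul_self]
      exact mul_self_le_mul_self (apply_nonneg _ _) (le_univSeminorm hp a)
    · have h : univSeminorm G c a ≤ √(univSeminorm G c (star a * a)) :=
        univSeminorm_le fun p hp => Real.le_sqrt_of_sq_le (by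
          rw [sq, ← hp.star_mul_self]; exact le_univSeminorm hp _)
      calc _ ≤ √(univSeminorm G c (star a * a)) * √(univSeminorm G c (star a * a)) :=
            mul_self_le_mul_self (apply_nonneg _ _) h
        _ = _ := Real.mul_self_sqrt (apply_nonneg _ _)
  rel a b h := le_antisymm (univSeminorm_le fun p hp => (hp.rel a b h).le) (apply_nonneg _ _)

/-- The free `*`-algebra on the paths of `Λ`, with the universal `C*`-seminorm. -/
def Pre (_G : KGraph k Λ) (_c : TwoCocycle Λ) : Type (max u v) := FreeStar (Mor Λ)

namespace Pre

noncomputable instance : NonUnitalRing (Pre G c) :=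
  inferInstanceAs (NonUnitalRing (FreeStar (Mor Λ)))

noncomputable instance : Module ℂ (Pre G c) :=
  inferInstanceAs (Module ℂ (FreeStar (Mor Λ)))

noncomputable instance : StarRing (Pre G c) :=
  inferInstanceAs (StarRing (FreeStar (Mor Λ)))

noncomputable instance : NonUnitalSeminormedRing (Pre G c) where
  __ : NonUnitalRing (Pre G c) := inferInstance
  __ : SeminormedAddCommGroup (Pre G c) :=
    (univSeminorm G c).toAddGroupSeminorm.toSeminormedAddCommGroup
  norm_mul_le := (isCKSeminorm_univSeminorm G c).mul_le

/-- The identity map. -/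
def mk (a : FreeStar (Mor Λ)) : Pre G c := a

theorem norm_mk (a : FreeStar (Mor Λ)) : ‖(mk G c a)‖ = univSeminorm G c a := rfl

noncomputable instance : NormedSpace ℂ (Pre G c) where
  __ : Module ℂ (Pre G c) := inferInstance
  norm_smul_le z a := (map_smul_eq_mul (univSeminorm G c) z a).le

instance : IsScalarTower ℂ (Pre G c) (Pre G c) :=
  ⟨fun z a b => smul_assoc (M := ℂ) (N := FreeStar (Mor Λ)) (α := FreeStar (Mor Λ)) z a b⟩

instance : SMulCommClass ℂ (Pre G c) (Pre G c) :=
  ⟨fun z a b => smul_comm (M := ℂ) (N := FreeStar (Mor Λ)) (α := FreeStar (Mor Λ)) z a b⟩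

instance : StarModule ℂ (Pre G c) :=
  ⟨fun z a => star_smul (R := ℂ) (A := FreeStar (Mor Λ)) z a⟩

instance : PreCStar (Pre G c) :=
  ⟨fun a => ((isCKSeminorm_univSeminorm G c).star_mul_self a).ge⟩

/-- The identity map, as a `*`-homomorphism. -/
def mkHom : FreeStar (Mor Λ) →⋆ₙₐ[ℂ] Pre G c where
  toFun := mk G c
  map_smul' _ _ := rfl
  map_zero' := rfl
  map_add' _ _ := rfl
  map_mul' _ _ := rfl
  map_star' _ := rfl

end Pre

/-- The twisted `C*`-algebra `C*(Λ, c)`: the universal `C*`-algebra generated by a Cuntz-Krieger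
`(Λ, c)`-family, that is, the Hausdorff completion of the free `*`-algebra on the paths of `Λ` in
the universal `C*`-seminorm. -/
abbrev TwistedCStar : Type (max u v) := CStarCompletion (Pre G c)

/-- The canonical `*`-homomorphism from the free `*`-algebra on the paths of `Λ`. -/
noncomputable def ofFree : FreeStar (Mor Λ) →⋆ₙₐ[ℂ] TwistedCStar G c :=
  (CStarCompletion.coeHom (A := Pre G c)).comp (Pre.mkHom G c)

theorem norm_ofFree (a : FreeStar (Mor Λ)) : ‖ofFree G c a‖ = univSeminorm G c a :=
  UniformSpace.Completion.norm_coe (Pre.mk G c a)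

theorem denseRange_ofFree : DenseRange (ofFree G c) :=
  UniformSpace.Completion.denseRange_coe (α := Pre G c)

/-- The universal Cuntz-Krieger `(Λ, c)`-family in `C*(Λ, c)`. -/
noncomputable def univFamily ⦃x y : Λ⦄ (f : x ⟶ y) : TwistedCStar G c := ofFree G c (gen f)

variable {G c} in
theorem ofFree_eq_of_rel {a b : FreeStar (Mor Λ)} (h : Rel G c a b) :
    ofFree G c a = ofFree G c b := by
  rw [← sub_eq_zero, ← map_sub, ← norm_eq_zero, norm_ofFree]
  exact (isCKSeminorm_univSeminorm G c).rel a b h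

theorem isCKFamily_univFamily : IsCKFamily G c (univFamily G c) where
  ck1_proj x :=
    ⟨by simpa only [univFamily, IsIdempotentElem, IsSelfAdjoint, map_mul] using ofFree_eq_of_rel (Rel.ck1_mul (G := G) (c := c) x),
     by simpa only [univFamily, IsIdempotentElem, IsSelfAdjoint, map_star] using ofFree_eq_of_rel (Rel.ck1_star (G := G) (c := c) x)⟩
  ck1_orth x y h := by
    simpa only [univFamily, map_mul, map_zero] using ofFree_eq_of_rel (Rel.ck1_orth (G := G) (c := c) x y h)
  ck2 x y z μ ν := by
    simpa only [univFamily, map_mul, map_smul] using ofFree_eq_of_rel (Rel.ck2 (G := G) (c := c) μ ν)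
  ck3 x y f := by
    simpa only [univFamily, map_mul, map_star] using ofFree_eq_of_rel (Rel.ck3 (G := G) (c := c) f)
  ck4 y n F hF := by
    simpa only [univFamily, map_sum, map_mul, map_star] using
      ofFree_eq_of_rel (Rel.ck4 (G := G) (c := c) y n F hF)

section induced

variable {G c} {B : Type w} [NonUnitalCStarAlgebra B] {t : ∀ ⦃x y : Λ⦄, (x ⟶ y) → B}

/-- The `*`-homomorphism on the free `*`-algebra carrying the generator of `f` to `t f`. -/
noncomputable def freeLift (t : ∀ ⦃x y : Λ⦄, (x ⟶ y) → B) : FreeStar (Mor Λ) →⋆ₙₐ[ℂ] B :=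
  FreeStar.lift fun p => t p.2.2

theorem freeLift_gen (t : ∀ ⦃x y : Λ⦄, (x ⟶ y) → B) {x y : Λ} (f : x ⟶ y) :
    freeLift t (gen f) = t f := FreeStar.lift_of _ _

/-- The seminorm `a ↦ ‖φ a‖` of the `*`-homomorphism `φ` determined by a family. -/
noncomputable def liftSeminorm (t : ∀ ⦃x y : Λ⦄, (x ⟶ y) → B) :
    Seminorm ℂ (FreeStar (Mor Λ)) :=
  Seminorm.of (fun a => ‖freeLift t a‖) (fun a b => by rw [map_add]; exact norm_add_le _ _)
    (fun z a => by rw [map_smul, norm_smul])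

theorem IsCKFamily.freeLift_eq (ht : IsCKFamily G c t) {a b : FreeStar (Mor Λ)}
    (h : Rel G c a b) : freeLift t a = freeLift t b := by
  cases h with
  | ck1_mul x => simpa only [map_mul, freeLift_gen] using (ht.ck1_proj x).isIdempotentElem.eq
  | ck1_star x => simpa only [map_star, freeLift_gen] using (ht.ck1_proj x).isSelfAdjoint.star_eq
  | ck1_orth x y h => simpa only [map_mul, map_zero, freeLift_gen] using ht.ck1_orth x y h
  | ck2 μ ν => simpa only [map_mul, map_smul, freeLift_gen] using ht.ck2 μ ν
  | ck3 f => simpa only [map_mul, map_star, freeLift_gen] using ht.ck3 f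
  | ck4 y n F hF =>
    simpa only [map_sum, map_mul, map_star, freeLift_gen] using ht.ck4 y n F hF

theorem IsCKFamily.isCKSeminorm (ht : IsCKFamily G c t) : IsCKSeminorm G c (liftSeminorm t) where
  mul_le a b := by
    change ‖freeLift t (a * b)‖ ≤ ‖freeLift t a‖ * ‖freeLift t b‖
    rw [map_mul]
    exact norm_mul_le _ _
  star_mul_self a := by
    change ‖freeLift t (star a * a)‖ = ‖freeLift t a‖ * ‖freeLift t a‖
    rw [map_mul, map_star]
    exact CStarRing.norm_star_mul_self
  rel a b h := by
    change ‖freeLift t (a - b)‖ = 0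
    rw [map_sub, ht.freeLift_eq h, sub_self, norm_zero]

/-- The `*`-homomorphism `π_t : C*(Λ, c) → B` induced by a Cuntz-Krieger `(Λ, c)`-family `t`
in `B`. -/
noncomputable def IsCKFamily.inducedHom (ht : IsCKFamily G c t) : TwistedCStar G c →⋆ₙₐ[ℂ] B :=
  CStarCompletion.extend (A := Pre G c)
    { toFun := fun a : FreeStar (Mor Λ) => freeLift t a
      map_smul' := map_smul (freeLift t)
      map_zero' := map_zero (freeLift t)
      map_add' := map_add (freeLift t)
      map_mul' := map_mul (freeLift t)
      map_star' := map_star (freeLift t) }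
    (fun a : FreeStar (Mor Λ) => le_univSeminorm ht.isCKSeminorm a)

theorem IsCKFamily.inducedHom_ofFree (ht : IsCKFamily G c t) (a : FreeStar (Mor Λ)) :
    ht.inducedHom (ofFree G c a) = freeLift t a :=
  CStarCompletion.extend_coe (A := Pre G c) _ _ (Pre.mk G c a)

/-- `π_t ∘ s = t`. -/
theorem IsCKFamily.inducedHom_univFamily (ht : IsCKFamily G c t) {x y : Λ} (f : x ⟶ y) :
    ht.inducedHom (univFamily G c f) = t f := by
  rw [univFamily, ht.inducedHom_ofFree, freeLift_gen]

/-- `π_t` is the only `*`-homomorphism with `π_t ∘ s = t`. -/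
theorem IsCKFamily.inducedHom_unique (ht : IsCKFamily G c t) (φ : TwistedCStar G c →⋆ₙₐ[ℂ] B)
    (hφ : ∀ ⦃x y : Λ⦄ (f : x ⟶ y), φ (univFamily G c f) = t f) : φ = ht.inducedHom := by
  have hfree : ∀ a, φ (ofFree G c a) = ht.inducedHom (ofFree G c a) := by
    have hl : ∀ q : Mor Λ × Bool, φ (ofFree G c (FreeStar.mono (FreeSemigroup.of q) 1)) =
        ht.inducedHom (ofFree G c (FreeStar.mono (FreeSemigroup.of q) 1)) := by
      rintro ⟨⟨x, y, f⟩, b⟩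
      have h : φ (ofFree G c (gen f)) = ht.inducedHom (ofFree G c (gen f)) :=
        (hφ f).trans (ht.inducedHom_univFamily f).symm
      cases b
      · exact h
      · have : FreeStar.mono (FreeSemigroup.of ((⟨x, y, f⟩ : Mor Λ), true)) 1 =
            star (gen f) := by
          simp [gen, FreeStar.of, FreeStar.star_mono, FreeStar.wordStar_of]
        rw [this, map_star, map_star, map_star, h]
    intro a
    induction a using FreeStar.induction with
    | h0 => simp only [map_zero]
    | hadd a b ha hb => simp only [map_add, ha, hb]
    | hm w z =>
      have : FreeStar.mono w z = z • FreeStar.mono w 1 := by rw [FreeStar.smul_mono, mul_one]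
      rw [this, map_smul, map_smul, map_smul]
      congr 1
      clear this
      induction w using FreeSemigroup.recOnMul with
      | ih1 q => exact hl q
      | ih2 q w hq hw =>
        have : FreeStar.mono (FreeSemigroup.of q * w) 1 =
            FreeStar.mono (FreeSemigroup.of q) 1 * FreeStar.mono w 1 := by
          rw [FreeStar.mono_mul, mul_one]
        rw [this, map_mul, map_mul, map_mul, hl q]
        congr 1
  have hcont : ∀ ψ : TwistedCStar G c →⋆ₙₐ[ℂ] B, Continuous ψ := fun ψ =>
    AddMonoidHomClass.continuous_of_bound ψ 1 fun a => by
      rw [one_mul]; exact NonUnitalStarAlgHom.norm_apply_le ψ a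
  refine DFunLike.coe_injective ((denseRange_ofFree G c).equalizer (hcont φ) (hcont _) ?_)
  exact funext hfree

end induced

end twisted

end TwistedKGraph

namespace TwistedKGraph

universe u v w

/-! ### Algebra in Cuntz-Krieger families -/

/-! Write `π` for the induced homomorphism and `s` for the universal family.

Suppose all `t_v` are nonzero. It is enough to prove `‖a‖ ≤ ‖π a‖` on the dense `*`-algebra spanned
by the `s_μ s_ν^*`, which is graded over `ℤ^k` by `d(μ) - d(ν)`. No conditional expectation is used.
By the C*-identity, `‖x‖ ^ 2^(j+1)` is the norm of `(x^* x)^(2^j)`. Hence an estimate with a loss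
polynomial in `2^(j+1)` along these powers already gives the estimate with constant one
(`norm_le_norm_map_of_growth`). This device is applied twice.

In degree zero, an element lies in the span of matrix units `s_μ s_ν^*` with `μ, ν` in a finite set
`E` of paths of one common degree. Each entry of the matrix is a scalar times a vertex projection,
so nonvanishing of the `t_v` gives `‖a‖ ≤ |E|^2 ‖π a‖`. The powers of `a^* a` stay in the same span,
so the constant disappears (`norm_le_norm_map_of_mem_gradedSpan_zero`). Passing to `a^* a` extends
the bound to every homogeneous `a`.

For a sum `a` of components with degrees in a box of radius `M`, averaging `β` over roots of unity
bounds each component of `π a` by `‖π a‖`. Therefore `‖a‖ ≤ (2M+1)^k ‖π a‖`. The box radius of `(a^*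
a)^(2^j)` is `2^(j+1) M`, so the loss is polynomial and disappears too
(`norm_le_norm_map_of_mem_boundedSpan`).

Conversely, if `π` is injective it remains to see that `s_v ≠ 0`, that is, that some C*-seminorm
compatible with the relations does not vanish at `v`. The twisted left regular representation on
`ℓ²(Λ)` satisfies (CK1)-(CK3), but (CK4) in degree `n` is guaranteed only on paths of degree at
least `n`. The limit, as `N` grows, of the norms restricted to paths of degree at least `N` is a
C*-seminorm in which all the relations hold (`isCKSeminorm_tailSeminorm`). Since there are no
sources, every vertex has value at least one (`one_le_tailSeminorm_gen_id`). -/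

/-- If finitely many star projections sum to a star projection, they are mutually orthogonal. -/
theorem mul_eq_zero_of_sum_isStarProjection {B : Type w} [NonUnitalCStarAlgebra B] {ι : Type*}
    {F : Finset ι} {P : ι → B} (hP : ∀ i ∈ F, IsStarProjection (P i))
    (hsum : IsStarProjection (∑ i ∈ F, P i)) {i j : ι} (hi : i ∈ F) (hj : j ∈ F) (hij : i ≠ j) :
    P i * P j = 0 := by
  classical
  let _ := CStarAlgebra.spectralOrder B
  have := CStarAlgebra.spectralOrderedRing B
  have hle : P i ≤ ∑ l ∈ F, P l :=
    Finset.single_le_sum (fun l hl => (hP l hl).nonneg) hi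
  have h1 : P i * (∑ l ∈ F, P l) = P i :=
    ((hP i hi).le_iff_mul_eq_left hsum).1 hle
  have h2 : ∑ l ∈ F.erase i, P i * P l = 0 := by
    have := Finset.add_sum_erase F (fun l => P i * P l) hi
    rw [← Finset.mul_sum F P (P i), h1, (hP i hi).isIdempotentElem.eq] at this
    simpa using this
  -- Each term equals `P_i P_l P_i` and is positive. Their sum vanishes by `h2`, so each of them
  -- vanishes.
  have h3 : ∑ l ∈ F.erase i, (P i * P l) * star (P i * P l) = 0 := by
    have : ∀ l ∈ F.erase i, (P i * P l) * star (P i * P l) = (P i * P l) * P i := by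
      intro l hl
      have hl' := hP l (Finset.mem_of_mem_erase hl)
      rw [star_mul, hl'.isSelfAdjoint.star_eq, (hP i hi).isSelfAdjoint.star_eq, ← mul_assoc,
        mul_assoc (P i), hl'.isIdempotentElem.eq]
    rw [Finset.sum_congr rfl this, ← Finset.sum_mul, h2, zero_mul]
  have h4 := (Finset.sum_eq_zero_iff_of_nonneg (fun l _ => mul_star_self_nonneg (P i * P l))).1 h3 j
    (Finset.mem_erase.2 ⟨hij.symm, hj⟩)
  exact CStarRing.mul_star_self_eq_zero_iff _ |>.1 h4

section families

variable {k : ℕ} {Λ : Type u} [Category.{v} Λ] {G : KGraph k Λ} {c : TwoCocycle Λ}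
  {B : Type w} [NonUnitalCStarAlgebra B] {t : ∀ ⦃x y : Λ⦄, (x ⟶ y) → B}

namespace IsCKFamily

theorem mul_id (ht : IsCKFamily G c t) {x y : Λ} (f : x ⟶ y) : t f * t (𝟙 x) = t f := by
  rw [ht.ck2, c.map_id_right]; simp

theorem id_mul (ht : IsCKFamily G c t) {x y : Λ} (f : x ⟶ y) : t (𝟙 y) * t f = t f := by
  rw [ht.ck2, c.map_id_left]; simp

theorem star_id (ht : IsCKFamily G c t) (x : Λ) : star (t (𝟙 x)) = t (𝟙 x) :=
  (ht.ck1_proj x).isSelfAdjoint.star_eq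

theorem star_mul_id (ht : IsCKFamily G c t) {x y : Λ} (f : x ⟶ y) :
    star (t f) * t (𝟙 y) = star (t f) := by
  rw [← ht.star_id, ← star_mul, ht.id_mul]

theorem id_mul_star (ht : IsCKFamily G c t) {x y : Λ} (f : x ⟶ y) :
    t (𝟙 x) * star (t f) = star (t f) := by
  rw [← ht.star_id, ← star_mul, ht.mul_id]

theorem star_mul_of_range_ne (ht : IsCKFamily G c t) {x y x' y' : Λ} (f : x ⟶ y) (f' : x' ⟶ y')
    (h : y ≠ y') : star (t f) * t f' = 0 := by
  rw [← ht.star_mul_id, ← ht.id_mul f', mul_assoc, ← mul_assoc (t (𝟙 y)), ht.ck1_orth _ _ h,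
    zero_mul, mul_zero]

theorem mul_star_of_source_ne (ht : IsCKFamily G c t) {x y x' y' : Λ} (f : x ⟶ y) (f' : x' ⟶ y')
    (h : x ≠ x') : t f * star (t f') = 0 := by
  rw [← ht.mul_id, ← ht.id_mul_star f', mul_assoc, ← mul_assoc (t (𝟙 x)), ht.ck1_orth _ _ h,
    zero_mul, mul_zero]

theorem isStarProjection_mul_star (ht : IsCKFamily G c t) {x y : Λ} (f : x ⟶ y) :
    IsStarProjection (t f * star (t f)) where
  isIdempotentElem := by
    rw [IsIdempotentElem, mul_assoc, ← mul_assoc (star (t f)), ht.ck3, ht.id_mul_star]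
  isSelfAdjoint := by simp [IsSelfAdjoint]

/-- For a common range `v`, (CK4) writes the projection `t_v` as the sum of the range projections of
the paths of that degree, so these are mutually orthogonal. For different ranges the vertex
projections already separate the two factors. -/
theorem star_mul_of_deg_eq (ht : IsCKFamily G c t) (hrow : G.RowFinite) {p q : Mor Λ}
    (hdeg : G.deg p.2.2 = G.deg q.2.2) (hne : p ≠ q) : star (t p.2.2) * t q.2.2 = 0 := by
  obtain ⟨x, y, f⟩ := p
  obtain ⟨x', y', f'⟩ := q
  by_cases hy : y = y'
  swap
  · exact ht.star_mul_of_range_ne _ _ hy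
  subst hy
  have hF := (hrow y (G.deg f)).coe_toFinset
  have hsum := ht.ck4 y _ _ hF
  have key := mul_eq_zero_of_sum_isStarProjection
    (P := fun p : Σ x : Λ, x ⟶ y => t p.2 * star (t p.2))
    (fun p _ => ht.isStarProjection_mul_star p.2) (hsum ▸ ht.ck1_proj y)
    (i := ⟨x, f⟩) (j := ⟨x', f'⟩) (by simp [KGraph.pathsInto]) (by simp [KGraph.pathsInto, hdeg.symm])
    (by rintro h; cases h; exact hne rfl)
  calc star (t f) * t f' = (star (t f) * t f) * star (t f) * (t f' * (star (t f') * t f')) := by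
        rw [ht.ck3, ht.ck3, ht.id_mul_star, ht.mul_id]
    _ = star (t f) * (t f * star (t f) * (t f' * star (t f'))) * t f' := by simp only [mul_assoc]
    _ = 0 := by rw [key]; simp

theorem norm_id_le_one (ht : IsCKFamily G c t) (x : Λ) : ‖t (𝟙 x)‖ ≤ 1 := (ht.ck1_proj x).norm_le

theorem norm_le_one (ht : IsCKFamily G c t) {x y : Λ} (f : x ⟶ y) : ‖t f‖ ≤ 1 := by
  have h : ‖t f‖ * ‖t f‖ ≤ 1 := by
    rw [← CStarRing.norm_star_mul_self, ht.ck3]; exact ht.norm_id_le_one x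
  nlinarith [norm_nonneg (t f)]

theorem norm_id_eq_one (ht : IsCKFamily G c t) {x : Λ} (hx : t (𝟙 x) ≠ 0) : ‖t (𝟙 x)‖ = 1 := by
  have h := CStarRing.norm_star_mul_self (x := t (𝟙 x))
  rw [ht.ck3] at h
  have h' := norm_pos_iff.2 hx
  nlinarith

end IsCKFamily

/-! ### The grading by `ℤ^k` -/

/-- The degree of a path as an integer vector. -/
def KGraph.intDeg (G : KGraph k Λ) (p : Mor Λ) : Fin k → ℤ := fun i => (G.deg p.2.2 i : ℤ)

/-- The span of the elements `t_μ` with `μ` of degree `g`. -/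
def pathSpan (G : KGraph k Λ) (t : ∀ ⦃x y : Λ⦄, (x ⟶ y) → B) (g : Fin k → ℤ) : Submodule ℂ B :=
  Submodule.span ℂ {b | ∃ p : Mor Λ, G.intDeg p = g ∧ t p.2.2 = b}

/-- The span of the elements `t_μ t_ν^*` with `d(μ) - d(ν) = g`. -/
def gradedSpan (G : KGraph k Λ) (t : ∀ ⦃x y : Λ⦄, (x ⟶ y) → B) (g : Fin k → ℤ) : Submodule ℂ B :=
  Submodule.span ℂ {b | ∃ p q : Mor Λ, G.intDeg p - G.intDeg q = g ∧ t p.2.2 * star (t q.2.2) = b}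

theorem mul_star_mem_gradedSpan_of_mem_pathSpan {g h : Fin k → ℤ} {a b : B}
    (ha : a ∈ pathSpan G t g) (hb : b ∈ pathSpan G t h) : a * star b ∈ gradedSpan G t (g - h) := by
  induction ha using Submodule.span_induction with
  | zero => simp
  | add x y _ _ hx hy => rw [add_mul]; exact add_mem hx hy
  | smul z x _ hx => rw [smul_mul_assoc]; exact Submodule.smul_mem _ _ hx
  | mem x hx =>
    obtain ⟨p, hp, rfl⟩ := hx
    induction hb using Submodule.span_induction with
    | zero => simp
    | add x y _ _ hx hy => rw [star_add, mul_add]; exact add_mem hx hy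
    | smul z x _ hx => rw [star_smul, mul_smul_comm]; exact Submodule.smul_mem _ _ hx
    | mem x hx =>
      obtain ⟨q, hq, rfl⟩ := hx
      exact Submodule.subset_span ⟨p, q, by rw [hp, hq], rfl⟩

theorem star_mem_gradedSpan {g : Fin k → ℤ} {a : B} (ha : a ∈ gradedSpan G t g) :
    star a ∈ gradedSpan G t (-g) := by
  induction ha using Submodule.span_induction with
  | zero => simp
  | add x y _ _ hx hy => rw [star_add]; exact add_mem hx hy
  | smul z x _ hx => rw [star_smul]; exact Submodule.smul_mem _ _ hx
  | mem x hx =>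
    obtain ⟨p, q, hp, rfl⟩ := hx
    exact Submodule.subset_span ⟨q, p, by rw [← hp, neg_sub], by simp⟩

namespace IsCKFamily

/-- Since `d(q) ≤ d(l)`, factor `l = l₁ l₂` with `d(l₁) = d(q)`. Then `t_q^* t_{l₁}` is zero or a
vertex projection, so no adjoint survives. -/
theorem mul_star_mul_mem_pathSpan (ht : IsCKFamily G c t) (hrow : G.RowFinite) (p q l : Mor Λ)
    (hle : G.deg q.2.2 ≤ G.deg l.2.2) :
    t p.2.2 * star (t q.2.2) * t l.2.2 ∈ pathSpan G t (G.intDeg p - G.intDeg q + G.intDeg l) := by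
  obtain ⟨x, y, f⟩ := p
  obtain ⟨x', y', h⟩ := q
  obtain ⟨a, b, l⟩ := l
  by_cases hx : x = x'
  swap
  · simp only [ht.mul_star_of_source_ne _ _ hx, zero_mul]; exact zero_mem _
  subst hx
  obtain ⟨⟨z, l₁, l₂⟩, ⟨h1, h2, h3⟩, -⟩ :=
    G.factorisation l (G.deg h) (G.deg l - G.deg h) (add_tsub_cancel_of_le hle).symm
  simp only at h1 h2 h3 hle ⊢
  -- The cocycle takes unimodular values, so (CK2) can be inverted by conjugating the scalar.
  have hl : t l = (star (c.toFun l₁ l₂ : ℂ)) • (t l₁ * t l₂) := by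
    rw [ht.ck2, h3, smul_smul]; simp [← Circle.coe_inv_eq_conj]
  rw [hl, mul_smul_comm]
  refine Submodule.smul_mem _ _ ?_
  by_cases hq : (⟨x, y', h⟩ : Mor Λ) = ⟨z, b, l₁⟩
  · cases hq
    have : t f * star (t h) * (t h * t l₂) = (c.toFun f l₂ : ℂ) • t (l₂ ≫ f) := by
      rw [← ht.ck2, mul_assoc, ← mul_assoc (star (t h)), ht.ck3, ht.id_mul]
    rw [this]
    refine Submodule.smul_mem _ _ (Submodule.subset_span ⟨⟨_, _, l₂ ≫ f⟩, ?_, rfl⟩)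
    ext i
    have := congrFun h2 i
    have := hle i
    simp only [KGraph.intDeg, G.deg_comp, Pi.add_apply, Pi.sub_apply] at *
    omega
  · have := ht.star_mul_of_deg_eq hrow (p := ⟨x, y', h⟩) (q := ⟨z, b, l₁⟩) h1.symm hq
    simp only at this
    rw [mul_assoc, ← mul_assoc (star (t h)), this]
    simp

/-- In `t_p t_q^* t_{p'} t_{q'}^*`, insert (CK4) at `r(q)` for the join of `d(q)` and `d(p')`. Every
inserted path is long enough to absorb both inner adjoints. -/
theorem mul_mem_gradedSpan (ht : IsCKFamily G c t) (hrow : G.RowFinite) {g h : Fin k → ℤ} {a b : B}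
    (ha : a ∈ gradedSpan G t g) (hb : b ∈ gradedSpan G t h) : a * b ∈ gradedSpan G t (g + h) := by
  induction ha using Submodule.span_induction with
  | zero => simp
  | add x y _ _ hx hy => rw [add_mul]; exact add_mem hx hy
  | smul z x _ hx => rw [smul_mul_assoc]; exact Submodule.smul_mem _ _ hx
  | mem x hx =>
    obtain ⟨p, q, hp, rfl⟩ := hx
    induction hb using Submodule.span_induction with
    | zero => simp
    | add x y _ _ hx hy => rw [mul_add]; exact add_mem hx hy
    | smul z x _ hx => rw [mul_smul_comm]; exact Submodule.smul_mem _ _ hx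
    | mem x hx =>
      obtain ⟨p', q', hp', rfl⟩ := hx
      have hF := (hrow q.2.1 (G.deg q.2.2 ⊔ G.deg p'.2.2)).coe_toFinset
      have : t p.2.2 * star (t q.2.2) * (t p'.2.2 * star (t q'.2.2)) =
          ∑ l ∈ (hrow q.2.1 (G.deg q.2.2 ⊔ G.deg p'.2.2)).toFinset,
            (t p.2.2 * star (t q.2.2) * t l.2) * star (t q'.2.2 * star (t p'.2.2) * t l.2) := by
        conv_lhs => rw [← ht.star_mul_id q.2.2, ht.ck4 _ _ _ hF, Finset.mul_sum, Finset.mul_sum,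
          Finset.sum_mul]
        simp only [star_mul, star_star, mul_assoc]
      rw [this]
      refine sum_mem fun l hl => ?_
      have hl : G.deg l.2 = G.deg q.2.2 ⊔ G.deg p'.2.2 := by
        simpa [KGraph.pathsInto] using hl
      have := mul_star_mem_gradedSpan_of_mem_pathSpan
        (ht.mul_star_mul_mem_pathSpan hrow p q ⟨_, _, l.2⟩ (hl ▸ le_sup_left))
        (ht.mul_star_mul_mem_pathSpan hrow q' p' ⟨_, _, l.2⟩ (hl ▸ le_sup_right))
      rwa [show G.intDeg p - G.intDeg q + G.intDeg ⟨_, _, l.2⟩ -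
        (G.intDeg q' - G.intDeg p' + G.intDeg ⟨_, _, l.2⟩) = g + h by rw [← hp, ← hp']; abel] at this

end IsCKFamily

end families

/-! ### Norm comparison by polynomial growth -/

/-- If `a > b`, then `(a/b) ^ N` grows exponentially in `N = 2^(j+1)` and overtakes `C * N ^ k`. -/
theorem le_of_pow_le_mul_pow {a b C : ℝ} {k : ℕ} (hb : 0 ≤ b)
    (h : ∀ j : ℕ, a ^ 2 ^ (j + 1) ≤ C * ((2 : ℝ) ^ (j + 1)) ^ k * b ^ 2 ^ (j + 1)) : a ≤ b := by
  by_contra! hlt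
  rcases hb.eq_or_lt with rfl | hb
  · have := h 0
    rw [zero_pow (by positivity), mul_zero] at this
    exact absurd (pow_pos hlt _) this.not_gt
  have hr : 1 < a / b := (one_lt_div hb).2 hlt
  have hlim := (tendsto_pow_const_div_const_pow_of_one_lt k hr).comp
    ((tendsto_pow_atTop_atTop_of_one_lt (one_lt_two (α := ℕ))).comp (Filter.tendsto_add_atTop_nat 1))
  obtain ⟨j, hj⟩ := (hlim.eventually_lt_const (show (0 : ℝ) < 1 / (|C| + 1) by positivity)).exists
  -- The threshold `1 / (|C| + 1)` keeps the denominator positive whatever the sign of `C`.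
  simp only [Function.comp_apply, Nat.cast_pow, Nat.cast_ofNat] at hj
  have hpos : 0 < (a / b) ^ 2 ^ (j + 1) := by positivity
  rw [div_lt_div_iff₀ hpos (by positivity), one_mul, div_pow, lt_div_iff₀ (by positivity)] at hj
  have h1 : C * ((2 : ℝ) ^ (j + 1)) ^ k * b ^ 2 ^ (j + 1) ≤
      ((2 : ℝ) ^ (j + 1)) ^ k * (|C| + 1) * b ^ 2 ^ (j + 1) := by
    rw [mul_comm C]
    gcongr
    linarith [le_abs_self C]
  linarith [h j]

/-! ### Norms of iterated squares of `x^* x`. -/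

section sqIter

variable {A : Type u} [NonUnitalCStarAlgebra A] {B : Type w} [NonUnitalCStarAlgebra B]

/-- The powers `(x^* x)^(2^j)`. -/
def sqIter (x : A) : ℕ → A
  | 0 => star x * x
  | j + 1 => sqIter x j * sqIter x j

theorem isSelfAdjoint_sqIter (x : A) (j : ℕ) : IsSelfAdjoint (sqIter x j) := by
  induction j with
  | zero => exact .star_mul_self x
  | succ j ih => simp [sqIter, IsSelfAdjoint, ih.star_eq]

/-- Each iterate is self-adjoint, so the C*-identity doubles the exponent exactly at each squaring.
-/
theorem norm_sqIter (x : A) (j : ℕ) : ‖sqIter x j‖ = ‖x‖ ^ 2 ^ (j + 1) := by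
  induction j with
  | zero => rw [sqIter, CStarRing.norm_star_mul_self]; ring
  | succ j ih =>
    rw [sqIter]
    nth_rw 1 [← (isSelfAdjoint_sqIter x j).star_eq]
    rw [CStarRing.norm_star_mul_self, ih]
    ring

theorem map_sqIter (φ : A →⋆ₙₐ[ℂ] B) (x : A) (j : ℕ) : φ (sqIter x j) = sqIter (φ x) j := by
  induction j with
  | zero => simp [sqIter, map_star]
  | succ j ih => simp [sqIter, ih]

/-- Both norms are exact powers with exponent `2^(j+1)`. A factor polynomial in that exponent tends
to one after taking roots. -/
theorem norm_le_norm_map_of_growth (φ : A →⋆ₙₐ[ℂ] B) (x : A) (C : ℝ) (k : ℕ)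
    (h : ∀ j : ℕ, ‖sqIter x j‖ ≤ C * ((2 : ℝ) ^ (j + 1)) ^ k * ‖φ (sqIter x j)‖) :
    ‖x‖ ≤ ‖φ x‖ := by
  refine le_of_pow_le_mul_pow (C := C) (k := k) (norm_nonneg _) fun j => ?_
  have := h j
  rwa [map_sqIter, norm_sqIter, norm_sqIter] at this

end sqIter

/-! ### Averaging over finite tori -/

theorem sum_zpow_eq_zero {ω : ℂ} {N : ℕ} (hω : IsPrimitiveRoot ω N) {m : ℤ}
    (hm : m ≠ 0) (hmN : |m| < N) : ∑ j ∈ Finset.range N, (ω ^ m) ^ j = 0 := by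
  have h1 : ω ^ m ≠ 1 := fun h =>
    hm (Int.eq_zero_of_abs_lt_dvd ((hω.zpow_eq_one_iff_dvd m).1 h) hmN)
  have h2 : (ω ^ m) ^ N = 1 := by
    rw [← zpow_natCast, zpow_comm, zpow_natCast, hω.pow_eq_one, one_zpow]
  have := geom_sum_mul (ω ^ m) N
  rw [h2, sub_self] at this
  exact (mul_eq_zero.1 this).resolve_right (sub_ne_zero.2 h1)

/-- Homogeneous components for an action of the torus by contractions are bounded by the norm of the
sum. -/
theorem norm_component_le {k : ℕ} {B : Type w} [NormedAddCommGroup B] [NormedSpace ℂ B]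
    (U : (Fin k → Circle) → B →ₗ[ℂ] B) (hU : ∀ z b, ‖U z b‖ ≤ ‖b‖) (M : ℕ)
    (f : (Fin k → ℤ) → B)
    (hf : ∀ g z, U z (f g) = ((∏ i, z i ^ g i : Circle) : ℂ) • f g) {g : Fin k → ℤ}
    (hg : g ∈ Finset.Icc (fun _ => -(M : ℤ)) (fun _ => (M : ℤ))) :
    ‖f g‖ ≤ ‖∑ h ∈ Finset.Icc (fun _ : Fin k => -(M : ℤ)) (fun _ => (M : ℤ)), f h‖ := by
  set S := Finset.Icc (fun _ : Fin k => -(M : ℤ)) (fun _ => (M : ℤ)) with hS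
  -- Entries of the difference of two degrees in the box have absolute value at most `2M`, so `N`-th
  -- roots of unity distinguish all degrees that occur.
  set N : ℕ := 2 * M + 1 with hN
  have hN0 : 0 < N := Nat.succ_pos _
  set ω : Circle := Circle.exp (2 * Real.pi / N) with hω
  have hprim : IsPrimitiveRoot (ω : ℂ) N := by
    have := Complex.isPrimitiveRoot_exp N hN0.ne'
    rw [hω, Circle.coe_exp]
    convert this using 2
    push_cast
    ring
  set J := Fintype.piFinset fun _ : Fin k => Finset.range N with hJ
  set b := ∑ h ∈ S, f h with hb
  let z : (Fin k → ℕ) → Fin k → Circle := fun j i => ω ^ j i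
  have horth : ∀ h ∈ S, ∑ j ∈ J, ((∏ i, z j i ^ (h i - g i) : Circle) : ℂ) =
      if h = g then (N : ℂ) ^ k else 0 := by
    intro h hh
    have e1 : ∑ j ∈ J, ((∏ i, z j i ^ (h i - g i) : Circle) : ℂ) =
        ∏ i, ∑ j ∈ Finset.range N, ((ω : ℂ) ^ (h i - g i)) ^ j := by
      rw [Finset.prod_univ_sum]
      refine Finset.sum_congr rfl fun j _ => ?_
      refine (map_prod Circle.coeHom _ _).trans ?_
      refine Finset.prod_congr rfl fun i _ => ?_
      change ((ω ^ j i) ^ (h i - g i) : Circle).1 = _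
      rw [← zpow_natCast, zpow_comm, zpow_natCast]
      exact (Circle.coe_pow _ _).trans (by rw [Circle.coe_zpow])
    rw [e1]
    split_ifs with hgh
    · subst hgh; simp
    · obtain ⟨i, hi⟩ := Function.ne_iff.1 hgh
      refine Finset.prod_eq_zero (Finset.mem_univ i) (sum_zpow_eq_zero hprim (sub_ne_zero.2 hi) ?_)
      rw [hS, Finset.mem_Icc] at hg hh
      have := hg.1 i; have := hg.2 i; have := hh.1 i; have := hh.2 i
      simp only at *
      rw [abs_lt]
      constructor <;> push_cast [hN] <;> linarith
  -- A Fourier coefficient over the finite group of `N`-torsion points of the torus: summing against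
  -- the conjugate character isolates the component of degree `g`.
  have havg : ∑ j ∈ J, ((∏ i, z j i ^ (-g i) : Circle) : ℂ) • U (z j) b = (N : ℂ) ^ k • f g := by
    calc _ = ∑ j ∈ J, ∑ h ∈ S, ((∏ i, z j i ^ (h i - g i) : Circle) : ℂ) • f h := by
          refine Finset.sum_congr rfl fun j _ => ?_
          rw [hb, map_sum, Finset.smul_sum]
          refine Finset.sum_congr rfl fun h _ => ?_
          rw [hf, smul_smul, ← Circle.coe_mul, ← Finset.prod_mul_distrib]
          simp only [← zpow_add, neg_add_eq_sub]
      _ = ∑ h ∈ S, (if h = g then (N : ℂ) ^ k else 0) • f h := by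
          rw [Finset.sum_comm]
          refine Finset.sum_congr rfl fun h hh => ?_
          rw [← Finset.sum_smul, horth h hh]
      _ = _ := by simp [ite_smul, hg]
  have hnorm : (N : ℝ) ^ k * ‖f g‖ ≤ (N : ℝ) ^ k * ‖b‖ := by
    calc (N : ℝ) ^ k * ‖f g‖ = ‖(N : ℂ) ^ k • f g‖ := by rw [norm_smul]; simp
      _ ≤ ∑ j ∈ J, ‖b‖ := by
          rw [← havg]
          refine (norm_sum_le _ _).trans (Finset.sum_le_sum fun j _ => ?_)
          rw [norm_smul, Circle.norm_coe, one_mul]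
          exact hU _ _
      _ = _ := by simp [hJ]
  exact le_of_mul_le_mul_left hnorm (by positivity)

section uniqueness

variable {k : ℕ} {Λ : Type u} [Category.{v} Λ] {G : KGraph k Λ} {c : TwoCocycle Λ}

/-! ### The core -/

section core

variable {B : Type w} [NonUnitalCStarAlgebra B] {t : ∀ ⦃x y : Λ⦄, (x ⟶ y) → B}

/-- The span of the elements `t_μ t_ν^*` with `μ, ν ∈ E`. -/
def matrixSpan (t : ∀ ⦃x y : Λ⦄, (x ⟶ y) → B) (E : Set (Mor Λ)) : Submodule ℂ B :=
  Submodule.span ℂ {b | ∃ p ∈ E, ∃ q ∈ E, t p.2.2 * star (t q.2.2) = b}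

theorem matrixSpan_mono {E F : Set (Mor Λ)} (h : E ⊆ F) : matrixSpan t E ≤ matrixSpan t F :=
  Submodule.span_mono fun _ ⟨p, hp, q, hq, hb⟩ => ⟨p, h hp, q, h hq, hb⟩

theorem star_mem_matrixSpan {E : Set (Mor Λ)} {a : B} (ha : a ∈ matrixSpan t E) :
    star a ∈ matrixSpan t E := by
  induction ha using Submodule.span_induction with
  | zero => simp
  | add x y _ _ hx hy => rw [star_add]; exact add_mem hx hy
  | smul z x _ hx => rw [star_smul]; exact Submodule.smul_mem _ _ hx
  | mem x hx =>
    obtain ⟨p, hp, q, hq, rfl⟩ := hx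
    exact Submodule.subset_span ⟨q, hq, p, hp, by simp⟩

theorem exists_finset_mem_matrixSpan {E : Set (Mor Λ)} {a : B} (ha : a ∈ matrixSpan t E) :
    ∃ F : Finset (Mor Λ), (F : Set (Mor Λ)) ⊆ E ∧ a ∈ matrixSpan t (F : Set (Mor Λ)) := by
  classical
  induction ha using Submodule.span_induction with
  | zero => exact ⟨∅, by simp, zero_mem _⟩
  | add x y _ _ hx hy =>
    obtain ⟨F, hF, hx⟩ := hx
    obtain ⟨F', hF', hy⟩ := hy
    refine ⟨F ∪ F', by simp [hF, hF'], add_mem (matrixSpan_mono ?_ hx) (matrixSpan_mono ?_ hy)⟩ <;>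
    simp
  | smul z x _ hx =>
    obtain ⟨F, hF, hx⟩ := hx
    exact ⟨F, hF, Submodule.smul_mem _ _ hx⟩
  | mem x hx =>
    obtain ⟨p, hp, q, hq, rfl⟩ := hx
    refine ⟨{p, q}, ?_, Submodule.subset_span ⟨p, by simp, q, by simp, rfl⟩⟩
    rintro r hr
    simp only [Finset.coe_insert, Finset.coe_singleton, Set.mem_insert_iff,
      Set.mem_singleton_iff] at hr
    rcases hr with rfl | rfl <;> assumption

/-- The set of all paths of degree `n`. -/
def KGraph.level (G : KGraph k Λ) (n : Fin k → ℕ) : Set (Mor Λ) := {p | G.deg p.2.2 = n}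

namespace IsCKFamily

/-- Insert (CK4) in degree `m` at the common source: every matrix unit of one level is a sum of
scalar multiples of matrix units of the higher level. -/
theorem matrixSpan_level_le (ht : IsCKFamily G c t) (hrow : G.RowFinite) (n m : Fin k → ℕ) :
    matrixSpan t (G.level n) ≤ matrixSpan t (G.level (n + m)) := by
  refine Submodule.span_le.2 ?_
  rintro _ ⟨⟨x, y, f⟩, hp, ⟨x', y', f'⟩, hq, rfl⟩
  by_cases hx : x = x'
  swap
  · simp only [ht.mul_star_of_source_ne _ _ hx]; exact zero_mem _
  subst hx
  have hF := (hrow x m).coe_toFinset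
  have : t f * star (t f') = ∑ l ∈ (hrow x m).toFinset,
      ((c.toFun f l.2 : ℂ) • t (l.2 ≫ f)) * star ((c.toFun f' l.2 : ℂ) • t (l.2 ≫ f')) := by
    conv_lhs => rw [← ht.mul_id f, ht.ck4 _ _ _ hF, Finset.mul_sum, Finset.sum_mul]
    simp only [← ht.ck2, star_mul, mul_assoc]
  simp only [this]
  refine sum_mem fun l hl => ?_
  have hl : G.deg l.2 = m := by simpa [KGraph.pathsInto] using hl
  rw [star_smul, smul_mul_smul_comm]
  have hp : G.deg f = n := hp
  have hq : G.deg f' = n := hq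
  exact Submodule.smul_mem _ _ (Submodule.subset_span
    ⟨⟨_, _, l.2 ≫ f⟩, by simp [KGraph.level, G.deg_comp, hl, hp],
      ⟨_, _, l.2 ≫ f'⟩, by simp [KGraph.level, G.deg_comp, hl, hq], rfl⟩)

/-- Degree zero forces `d(μ) = d(ν)` in each spanning element, and any two levels lie in a common
higher one. -/
theorem exists_mem_matrixSpan_level (ht : IsCKFamily G c t) (hrow : G.RowFinite) {a : B}
    (ha : a ∈ gradedSpan G t 0) : ∃ n, a ∈ matrixSpan t (G.level n) := by
  induction ha using Submodule.span_induction with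
  | zero => exact ⟨0, zero_mem _⟩
  | add x y _ _ hx hy =>
    obtain ⟨n, hx⟩ := hx
    obtain ⟨m, hy⟩ := hy
    exact ⟨n + m, add_mem (ht.matrixSpan_level_le hrow n m hx)
      (add_comm m n ▸ ht.matrixSpan_level_le hrow m n hy)⟩
  | smul z x _ hx =>
    obtain ⟨n, hx⟩ := hx
    exact ⟨n, Submodule.smul_mem _ _ hx⟩
  | mem x hx =>
    obtain ⟨p, q, hpq, rfl⟩ := hx
    refine ⟨G.deg p.2.2, Submodule.subset_span ⟨p, rfl, q, ?_, rfl⟩⟩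
    ext i
    have := congrFun hpq i
    simp only [KGraph.intDeg, Pi.sub_apply, Pi.zero_apply] at this
    omega

/-- Paths in `E` have equal degree, so the `t_μ t_ν^*` multiply like matrix units. The same `E`
serves for all products, which keeps the norm constant uniform over powers. -/
theorem mul_mem_matrixSpan (ht : IsCKFamily G c t) (hrow : G.RowFinite) {n : Fin k → ℕ}
    {E : Set (Mor Λ)} (hE : E ⊆ G.level n) {a b : B}
    (ha : a ∈ matrixSpan t E) (hb : b ∈ matrixSpan t E) : a * b ∈ matrixSpan t E := by
  induction ha using Submodule.span_induction with
  | zero => simp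
  | add x y _ _ hx hy => rw [add_mul]; exact add_mem hx hy
  | smul z x _ hx => rw [smul_mul_assoc]; exact Submodule.smul_mem _ _ hx
  | mem x hx =>
    obtain ⟨p, hp, q, hq, rfl⟩ := hx
    induction hb using Submodule.span_induction with
    | zero => simp
    | add x y _ _ hx hy => rw [mul_add]; exact add_mem hx hy
    | smul z x _ hx => rw [mul_smul_comm]; exact Submodule.smul_mem _ _ hx
    | mem x hx =>
      obtain ⟨p', hp', q', hq', rfl⟩ := hx
      rw [mul_assoc, ← mul_assoc (star (t q.2.2))]
      by_cases h : q = p'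
      · subst h
        rw [ht.ck3, ← mul_assoc]
        by_cases hs : p.1 = q.1
        · have : t p.2.2 * t (𝟙 q.1) = t p.2.2 := hs ▸ ht.mul_id p.2.2
          rw [this]
          exact Submodule.subset_span ⟨p, hp, q', hq', rfl⟩
        · have h0 := ht.mul_star_of_source_ne p.2.2 (𝟙 q.1) hs
          rw [ht.star_id] at h0
          rw [h0, zero_mul]; exact zero_mem _
      · rw [ht.star_mul_of_deg_eq hrow ((hE hq).trans (hE hp').symm) h]
        simp

/-- Compression of an element of `matrixSpan t E` to a matrix unit. -/
theorem exists_compression_eq (ht : IsCKFamily G c t) (hrow : G.RowFinite) {n : Fin k → ℕ}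
    {E : Set (Mor Λ)} (hE : E ⊆ G.level n) {a : B} (ha : a ∈ matrixSpan t E) {p q : Mor Λ}
    (hp : p ∈ E) (hq : q ∈ E) :
    ∃ z : ℂ, star (t p.2.2) * a * t q.2.2 = z • (t (𝟙 p.1) * t (𝟙 q.1)) := by
  induction ha using Submodule.span_induction with
  | zero => exact ⟨0, by simp⟩
  | add x y _ _ hx hy =>
    obtain ⟨z, hz⟩ := hx
    obtain ⟨z', hz'⟩ := hy
    exact ⟨z + z', by rw [mul_add, add_mul, hz, hz', add_smul]⟩
  | smul z x _ hx =>
    obtain ⟨z', hz'⟩ := hx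
    exact ⟨z * z', by rw [mul_smul_comm, smul_mul_assoc, hz', smul_smul]⟩
  | mem x hx =>
    obtain ⟨p', hp', q', hq', rfl⟩ := hx
    have e : star (t p.2.2) * (t p'.2.2 * star (t q'.2.2)) * t q.2.2 =
      (star (t p.2.2) * t p'.2.2) * (star (t q'.2.2) * t q.2.2) := by simp only [mul_assoc]
    rw [e]
    by_cases h : p = p'
    · by_cases h' : q' = q
      · subst h h'
        exact ⟨1, by rw [ht.ck3, ht.ck3, one_smul]⟩
      · exact ⟨0, by rw [ht.star_mul_of_deg_eq hrow ((hE hq').trans (hE hq).symm) h']; simp⟩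
    · exact ⟨0, by rw [ht.star_mul_of_deg_eq hrow ((hE hp).trans (hE hp').symm) h]; simp⟩

/-- The projection `∑ t_p t_p^*` over `p ∈ E` is a two-sided unit for the span, so multiplying by it
on both sides gives the expansion into matrix entries. -/
theorem eq_sum_compressions (ht : IsCKFamily G c t) (hrow : G.RowFinite) {n : Fin k → ℕ}
    {E : Finset (Mor Λ)} (hE : (E : Set (Mor Λ)) ⊆ G.level n) {a : B}
    (ha : a ∈ matrixSpan t (E : Set (Mor Λ))) :
    a = ∑ p ∈ E, ∑ q ∈ E, t p.2.2 * (star (t p.2.2) * a * t q.2.2) * star (t q.2.2) := by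
  induction ha using Submodule.span_induction with
  | zero => simp
  | add x y _ _ hx hy =>
    simp only [mul_add, add_mul, Finset.sum_add_distrib, ← hx, ← hy]
  | smul z x _ hx =>
    simp only [mul_smul_comm, smul_mul_assoc, ← Finset.smul_sum, ← hx]
  | mem x hx =>
    obtain ⟨p, hp, q, hq, rfl⟩ := hx
    rw [Finset.sum_eq_single_of_mem p hp, Finset.sum_eq_single_of_mem q hq]
    · have e : t p.2.2 * (star (t p.2.2) * (t p.2.2 * star (t q.2.2)) * t q.2.2) * star (t q.2.2) =
        t p.2.2 * (star (t p.2.2) * t p.2.2) * (star (t q.2.2) * t q.2.2 * star (t q.2.2)) := by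
        simp only [mul_assoc]
      rw [e, ht.ck3, ht.ck3, ht.mul_id, ht.id_mul_star]
    · intro q' hq' hne
      simp only [mul_assoc]
      rw [← mul_assoc (star (t q.2.2)), ht.star_mul_of_deg_eq hrow ((hE hq).trans (hE hq').symm)
        hne.symm]
      simp
    · intro p' hp' hne
      refine Finset.sum_eq_zero fun q' _ => ?_
      simp only [mul_assoc]
      rw [← mul_assoc (star (t p'.2.2)) (t p.2.2),
        ht.star_mul_of_deg_eq hrow ((hE hp').trans (hE hp).symm) hne]
      simp

end IsCKFamily

end core

/-! ### Isometry on the core. -/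

section comparison

variable {A : Type*} [NonUnitalCStarAlgebra A] {B : Type w} [NonUnitalCStarAlgebra B]
  {s : ∀ ⦃x y : Λ⦄, (x ⟶ y) → A} {t : ∀ ⦃x y : Λ⦄, (x ⟶ y) → B}

namespace IsCKFamily

/-- A comparison of the `|E|^2` matrix entries one by one: `φ` preserves the scalar in each entry,
and that scalar is visible in `B` because the vertex projections there are nonzero. -/
theorem norm_le_card_mul_norm_map (hs : IsCKFamily G c s) (ht : IsCKFamily G c t)
    (hrow : G.RowFinite) (φ : A →⋆ₙₐ[ℂ] B) (hφ : ∀ ⦃x y : Λ⦄ (f : x ⟶ y), φ (s f) = t f)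
    (hv : ∀ v : Λ, t (𝟙 v) ≠ 0) {n : Fin k → ℕ} {E : Finset (Mor Λ)}
    (hE : (E : Set (Mor Λ)) ⊆ G.level n) {a : A} (ha : a ∈ matrixSpan s (E : Set (Mor Λ))) :
    ‖a‖ ≤ (E.card : ℝ) ^ 2 * ‖φ a‖ := by
  have key : ∀ p ∈ E, ∀ q ∈ E,
      ‖s p.2.2 * (star (s p.2.2) * a * s q.2.2) * star (s q.2.2)‖ ≤ ‖φ a‖ := by
    intro p hp q hq
    have h1 : ‖s p.2.2 * (star (s p.2.2) * a * s q.2.2) * star (s q.2.2)‖ ≤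
        ‖star (s p.2.2) * a * s q.2.2‖ := by
      have h2 := norm_mul_le (s p.2.2 * (star (s p.2.2) * a * s q.2.2)) (star (s q.2.2))
      have h3 := norm_mul_le (s p.2.2) (star (s p.2.2) * a * s q.2.2)
      have h4 := hs.norm_le_one p.2.2
      have h5 := hs.norm_le_one q.2.2
      rw [norm_star] at h2
      exact h2.trans ((mul_le_of_le_one_right (norm_nonneg _) h5).trans
        (h3.trans (mul_le_of_le_one_left (norm_nonneg _) h4)))
    refine h1.trans ?_
    obtain ⟨z, hz⟩ := hs.exists_compression_eq hrow hE ha hp hq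
    have h2 : ‖star (t p.2.2) * φ a * t q.2.2‖ ≤ ‖φ a‖ := by
      have h2 := norm_mul_le (star (t p.2.2) * φ a) (t q.2.2)
      have h3 := norm_mul_le (star (t p.2.2)) (φ a)
      rw [norm_star] at h3
      exact h2.trans ((mul_le_of_le_one_right (norm_nonneg _) (ht.norm_le_one q.2.2)).trans
        (h3.trans (mul_le_of_le_one_left (norm_nonneg _) (ht.norm_le_one p.2.2))))
    have h3 : star (t p.2.2) * φ a * t q.2.2 = z • (t (𝟙 p.1) * t (𝟙 q.1)) := by
      have := congrArg φ hz
      simpa only [map_mul, map_star, map_smul, hφ] using this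
    rw [hz]
    -- With equal sources the entry is `z` times a vertex projection, of norm one in `B` and at most
    -- one in `A`. With different sources it is zero.
    by_cases hpq : p.1 = q.1
    · rw [h3, hpq, (ht.ck1_proj q.1).isIdempotentElem.eq, norm_smul, ht.norm_id_eq_one (hv _)] at h2
      rw [hpq, (hs.ck1_proj q.1).isIdempotentElem.eq, norm_smul]
      exact (mul_le_mul_of_nonneg_left (hs.norm_id_le_one _) (norm_nonneg _)).trans h2
    · rw [hs.ck1_orth _ _ hpq]; simp
  rw [hs.eq_sum_compressions hrow hE ha]
  nth_rw 2 [← hs.eq_sum_compressions hrow hE ha]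
  refine (norm_sum_le_of_le E fun p hp => norm_sum_le_of_le E fun q hq => key p hp q hq).trans_eq ?_
  simp only [Finset.sum_const, nsmul_eq_mul]
  ring

theorem norm_le_norm_map_of_mem_gradedSpan_zero (hs : IsCKFamily G c s) (ht : IsCKFamily G c t)
    (hrow : G.RowFinite) (φ : A →⋆ₙₐ[ℂ] B) (hφ : ∀ ⦃x y : Λ⦄ (f : x ⟶ y), φ (s f) = t f)
    (hv : ∀ v : Λ, t (𝟙 v) ≠ 0) {a : A} (ha : a ∈ gradedSpan G s 0) : ‖a‖ ≤ ‖φ a‖ := by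
  obtain ⟨n, han⟩ := hs.exists_mem_matrixSpan_level hrow ha
  obtain ⟨E, hE, haE⟩ := exists_finset_mem_matrixSpan han
  have hmem : ∀ j, sqIter a j ∈ matrixSpan s (E : Set (Mor Λ)) := by
    intro j
    induction j with
    | zero => exact hs.mul_mem_matrixSpan hrow hE (star_mem_matrixSpan haE) haE
    | succ j ih => exact hs.mul_mem_matrixSpan hrow hE ih ih
  -- The growth exponent is `0`, because `E` is the same for every power.
  refine norm_le_norm_map_of_growth φ a ((E.card : ℝ) ^ 2) 0 fun j => ?_
  simpa using hs.norm_le_card_mul_norm_map ht hrow φ hφ hv hE (hmem j)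

end IsCKFamily

end comparison

/-! ### Elements with finitely many homogeneous components -/

/-- The integer vectors with entries of absolute value at most `M`. -/
noncomputable def box (k M : ℕ) : Finset (Fin k → ℤ) := Finset.Icc (fun _ => -(M : ℤ)) (fun _ => (M : ℤ))

theorem mem_box {M : ℕ} {g : Fin k → ℤ} : g ∈ box k M ↔ ∀ i, |g i| ≤ M := by
  simp only [box, Finset.mem_Icc, Pi.le_def, abs_le, forall_and]

theorem card_box (k M : ℕ) : (box k M).card = (2 * M + 1) ^ k := by
  simp only [box, Pi.card_Icc, Int.card_Icc, Finset.prod_const, Finset.card_univ, Fintype.card_fin]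
  congr 1
  omega

section bounded

variable {B : Type w} [NonUnitalCStarAlgebra B] {t : ∀ ⦃x y : Λ⦄, (x ⟶ y) → B}

/-- Sums of homogeneous elements with degrees in `box k M`. -/
def boundedSpan (G : KGraph k Λ) (t : ∀ ⦃x y : Λ⦄, (x ⟶ y) → B) (M : ℕ) : Submodule ℂ B :=
  ⨆ g ∈ box k M, gradedSpan G t g

theorem gradedSpan_le_boundedSpan {M : ℕ} {g : Fin k → ℤ} (hg : g ∈ box k M) :
    gradedSpan G t g ≤ boundedSpan G t M :=
  le_iSup₂_of_le g hg le_rfl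

theorem boundedSpan_mono {M N : ℕ} (h : M ≤ N) : boundedSpan G t M ≤ boundedSpan G t N :=
  iSup₂_le fun _ hg => gradedSpan_le_boundedSpan
    (mem_box.2 fun i => (mem_box.1 hg i).trans (by exact_mod_cast h))

theorem exists_eq_sum_of_mem_boundedSpan {M : ℕ} {a : B} (ha : a ∈ boundedSpan G t M) :
    ∃ f : (Fin k → ℤ) → B, (∀ g, f g ∈ gradedSpan G t g) ∧ ∑ g ∈ box k M, f g = a := by
  obtain ⟨f, hf⟩ := (Submodule.mem_iSup_finset_iff_exists_sum _ _).1 ha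
  exact ⟨fun g => f g, fun g => (f g).2, hf⟩

theorem star_mem_boundedSpan {M : ℕ} {a : B} (ha : a ∈ boundedSpan G t M) :
    star a ∈ boundedSpan G t M := by
  obtain ⟨f, hf, rfl⟩ := exists_eq_sum_of_mem_boundedSpan ha
  rw [star_sum]
  exact sum_mem fun g hg => gradedSpan_le_boundedSpan
    (mem_box.2 fun i => by simpa using mem_box.1 hg i) (star_mem_gradedSpan (hf g))

theorem IsCKFamily.mul_mem_boundedSpan (ht : IsCKFamily G c t) (hrow : G.RowFinite) {M N : ℕ}
    {a b : B} (ha : a ∈ boundedSpan G t M) (hb : b ∈ boundedSpan G t N) :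
    a * b ∈ boundedSpan G t (M + N) := by
  obtain ⟨f, hf, rfl⟩ := exists_eq_sum_of_mem_boundedSpan ha
  obtain ⟨f', hf', rfl⟩ := exists_eq_sum_of_mem_boundedSpan hb
  rw [Finset.sum_mul_sum]
  refine sum_mem fun g hg => sum_mem fun h hh => gradedSpan_le_boundedSpan
    (mem_box.2 fun i => ?_) (ht.mul_mem_gradedSpan hrow (hf g) (hf' h))
  have := abs_add_le (g i) (h i)
  have := mem_box.1 hg i
  have := mem_box.1 hh i
  push_cast
  simp only [Pi.add_apply]
  linarith

theorem IsCKFamily.exists_mem_boundedSpan (ht : IsCKFamily G c t) {x y : Λ} (f : x ⟶ y) :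
    ∃ M, t f ∈ boundedSpan G t M := by
  -- The total degree bounds every coordinate, and `t_f = t_f t_{s(f)}^*` is homogeneous of degree
  -- `d(f)`.
  refine ⟨∑ i, G.deg f i, gradedSpan_le_boundedSpan (g := G.intDeg ⟨x, y, f⟩)
    (mem_box.2 fun i => ?_)
    (Submodule.subset_span ⟨⟨x, y, f⟩, ⟨x, x, 𝟙 x⟩, ?_, ?_⟩)⟩
  · simp only [KGraph.intDeg, Nat.abs_cast]
    exact_mod_cast Finset.single_le_sum (f := G.deg f) (fun _ _ => Nat.zero_le _)
      (Finset.mem_univ i)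
  · ext i
    simp [KGraph.intDeg, G.deg_id]
  · simp only [ht.star_id, ht.mul_id]

/-- Each word is a product of finitely many homogeneous elements. Estimates on `boundedSpan`
therefore cover the whole `*`-algebra generated by the family, which is dense in the universal case.
-/
theorem IsCKFamily.exists_freeLift_mem_boundedSpan (ht : IsCKFamily G c t) (hrow : G.RowFinite)
    (a : FreeStar (Mor Λ)) : ∃ M, freeLift t a ∈ boundedSpan G t M := by
  induction a using FreeStar.induction with
  | h0 => exact ⟨0, by simp⟩
  | hadd a b ha hb =>
    obtain ⟨M, ha⟩ := ha
    obtain ⟨N, hb⟩ := hb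
    refine ⟨M + N, ?_⟩
    rw [map_add]
    exact add_mem (boundedSpan_mono (Nat.le_add_right M N) ha)
      (boundedSpan_mono (Nat.le_add_left N M) hb)
  | hm w z =>
    simp only [freeLift, FreeStar.lift_mono]
    suffices h : ∃ M, FreeStar.wordLift (fun p : Mor Λ => t p.2.2) w ∈ boundedSpan G t M by
      obtain ⟨M, h⟩ := h
      exact ⟨M, Submodule.smul_mem _ _ h⟩
    induction w using FreeSemigroup.recOnMul with
    | ih1 q =>
      obtain ⟨⟨x, y, f⟩, b⟩ := q
      obtain ⟨M, hM⟩ := ht.exists_mem_boundedSpan f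
      cases b
      · exact ⟨M, by simpa [FreeStar.wordLift] using hM⟩
      · exact ⟨M, by simpa [FreeStar.wordLift] using star_mem_boundedSpan hM⟩
    | ih2 q w hq hw =>
      obtain ⟨M, hq⟩ := hq
      obtain ⟨N, hw⟩ := hw
      exact ⟨M + N, by rw [map_mul]; exact ht.mul_mem_boundedSpan hrow hq hw⟩

theorem gauge_apply_of_mem_gradedSpan (U : (Fin k → Circle) → (B ≃⋆ₐ[ℂ] B))
    (hU : ∀ (z : Fin k → Circle) ⦃x y : Λ⦄ (f : x ⟶ y),
      U z (t f) = ((∏ i, z i ^ G.deg f i : Circle) : ℂ) • t f) {g : Fin k → ℤ} {b : B}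
    (hb : b ∈ gradedSpan G t g) (z : Fin k → Circle) :
    U z b = ((∏ i, z i ^ g i : Circle) : ℂ) • b := by
  induction hb using Submodule.span_induction with
  | zero => simp
  | add x y _ _ hx hy => rw [map_add, hx, hy, smul_add]
  | smul a x _ hx => rw [map_smul, hx, smul_comm]
  | mem x hx =>
    obtain ⟨p, q, rfl, rfl⟩ := hx
    rw [map_mul, map_star, hU, hU, star_smul, smul_mul_smul_comm]
    congr 1
    have : (star (((∏ i, z i ^ G.deg q.2.2 i : Circle)) : ℂ)) =
        ((∏ i, z i ^ G.deg q.2.2 i : Circle)⁻¹ : Circle) :=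
      (Circle.coe_inv_eq_conj _).symm
    rw [this, ← Circle.coe_mul, ← Finset.prod_inv_distrib, ← Finset.prod_mul_distrib]
    simp only [KGraph.intDeg, Pi.sub_apply, zpow_sub, zpow_natCast]

end bounded

/-! ### Isometry on finite sums of homogeneous elements. -/

section comparison

variable {A : Type*} [NonUnitalCStarAlgebra A] {B : Type w} [NonUnitalCStarAlgebra B]
  {s : ∀ ⦃x y : Λ⦄, (x ⟶ y) → A} {t : ∀ ⦃x y : Λ⦄, (x ⟶ y) → B}

theorem map_mem_gradedSpan (φ : A →⋆ₙₐ[ℂ] B)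
    (hφ : ∀ ⦃x y : Λ⦄ (f : x ⟶ y), φ (s f) = t f) {g : Fin k → ℤ} {a : A}
    (ha : a ∈ gradedSpan G s g) : φ a ∈ gradedSpan G t g := by
  induction ha using Submodule.span_induction with
  | zero => simp
  | add x y _ _ hx hy => rw [map_add]; exact add_mem hx hy
  | smul z x _ hx => rw [map_smul]; exact Submodule.smul_mem _ _ hx
  | mem x hx =>
    obtain ⟨p, q, hpq, rfl⟩ := hx
    exact Submodule.subset_span ⟨p, q, hpq, by rw [map_mul, map_star, hφ, hφ]⟩

namespace IsCKFamily

/-- The element `a^* a` has degree zero, and the C*-identity transfers the bound on the core back to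
`a`. -/
theorem norm_le_norm_map_of_mem_gradedSpan (hs : IsCKFamily G c s) (ht : IsCKFamily G c t)
    (hrow : G.RowFinite) (φ : A →⋆ₙₐ[ℂ] B) (hφ : ∀ ⦃x y : Λ⦄ (f : x ⟶ y), φ (s f) = t f)
    (hv : ∀ v : Λ, t (𝟙 v) ≠ 0) {g : Fin k → ℤ} {a : A} (ha : a ∈ gradedSpan G s g) :
    ‖a‖ ≤ ‖φ a‖ := by
  have h0 : star a * a ∈ gradedSpan G s 0 :=
    neg_add_cancel g ▸ hs.mul_mem_gradedSpan hrow (star_mem_gradedSpan ha) ha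
  have := hs.norm_le_norm_map_of_mem_gradedSpan_zero ht hrow φ hφ hv h0
  rw [map_mul, map_star, CStarRing.norm_star_mul_self, CStarRing.norm_star_mul_self] at this
  exact (mul_self_le_mul_self_iff (norm_nonneg _) (norm_nonneg _)).2 this

/-- Each component is controlled by its image, and the gauge automorphisms of `B` bound that image
by `‖φ a‖`. The constant counts the degrees in the box. -/
theorem norm_le_card_box_mul_norm_map (hs : IsCKFamily G c s) (ht : IsCKFamily G c t)
    (hrow : G.RowFinite) (φ : A →⋆ₙₐ[ℂ] B) (hφ : ∀ ⦃x y : Λ⦄ (f : x ⟶ y), φ (s f) = t f)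
    (hv : ∀ v : Λ, t (𝟙 v) ≠ 0) (U : (Fin k → Circle) → (B ≃⋆ₐ[ℂ] B))
    (hU : ∀ (z : Fin k → Circle) ⦃x y : Λ⦄ (f : x ⟶ y),
      U z (t f) = ((∏ i, z i ^ G.deg f i : Circle) : ℂ) • t f)
    {M : ℕ} {a : A} (ha : a ∈ boundedSpan G s M) : ‖a‖ ≤ (2 * M + 1 : ℝ) ^ k * ‖φ a‖ := by
  obtain ⟨f, hf, rfl⟩ := exists_eq_sum_of_mem_boundedSpan ha
  have hcomp : ∀ g ∈ box k M, ‖f g‖ ≤ ‖φ (∑ g ∈ box k M, f g)‖ := by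
    intro g hg
    refine (hs.norm_le_norm_map_of_mem_gradedSpan ht hrow φ hφ hv (hf g)).trans ?_
    rw [map_sum]
    exact norm_component_le
      (fun z => { toFun := U z, map_add' := map_add (U z), map_smul' := map_smul (U z) })
      (fun z b => NonUnitalStarAlgHom.norm_apply_le (U z) b) M (fun g => φ (f g))
      (fun g z => gauge_apply_of_mem_gradedSpan U hU (map_mem_gradedSpan φ hφ (hf g)) z) hg
  refine (norm_sum_le_of_le _ hcomp).trans_eq ?_
  rw [Finset.sum_const, card_box, nsmul_eq_mul]
  push_cast
  rfl

/-- Each squaring doubles the box radius, so the constant for the `j`-th iterate is at most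
`(2M+1)^k (2^(j+1))^k`, polynomial in the exponent. -/
theorem norm_le_norm_map_of_mem_boundedSpan (hs : IsCKFamily G c s) (ht : IsCKFamily G c t)
    (hrow : G.RowFinite) (φ : A →⋆ₙₐ[ℂ] B) (hφ : ∀ ⦃x y : Λ⦄ (f : x ⟶ y), φ (s f) = t f)
    (hv : ∀ v : Λ, t (𝟙 v) ≠ 0) (U : (Fin k → Circle) → (B ≃⋆ₐ[ℂ] B))
    (hU : ∀ (z : Fin k → Circle) ⦃x y : Λ⦄ (f : x ⟶ y),
      U z (t f) = ((∏ i, z i ^ G.deg f i : Circle) : ℂ) • t f)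
    {M : ℕ} {a : A} (ha : a ∈ boundedSpan G s M) : ‖a‖ ≤ ‖φ a‖ := by
  have hmem : ∀ j, sqIter a j ∈ boundedSpan G s (2 ^ (j + 1) * M) := by
    intro j
    induction j with
    | zero =>
      have := hs.mul_mem_boundedSpan hrow (star_mem_boundedSpan ha) ha
      rwa [← two_mul] at this
    | succ j ih =>
      have := hs.mul_mem_boundedSpan hrow ih ih
      rwa [← two_mul, ← mul_assoc, ← pow_succ'] at this
  refine norm_le_norm_map_of_growth φ a ((2 * M + 1 : ℝ) ^ k) k fun j => ?_
  refine (hs.norm_le_card_box_mul_norm_map ht hrow φ hφ hv U hU (hmem j)).trans ?_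
  rw [← mul_pow]
  gcongr
  push_cast
  have : (1 : ℝ) ≤ 2 ^ (j + 1) := one_le_pow₀ one_le_two
  linarith

end IsCKFamily

end comparison

/-- The induced homomorphism of a gauge-equivariant family with nonzero vertex projections is
isometric, hence injective. -/
theorem IsCKFamily.injective_inducedHom {B : Type w} [NonUnitalCStarAlgebra B]
    {t : ∀ ⦃x y : Λ⦄, (x ⟶ y) → B} (ht : IsCKFamily G c t) (hrow : G.RowFinite)
    (hv : ∀ v : Λ, t (𝟙 v) ≠ 0) (U : (Fin k → Circle) → (B ≃⋆ₐ[ℂ] B))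
    (hU : ∀ (z : Fin k → Circle) ⦃x y : Λ⦄ (f : x ⟶ y),
      U z (t f) = ((∏ i, z i ^ G.deg f i : Circle) : ℂ) • t f) :
    Function.Injective ht.inducedHom := by
  have hs := isCKFamily_univFamily G c
  -- By uniqueness, the identity is the homomorphism induced by the universal family.
  have hext : ∀ b, freeLift (univFamily G c) b = ofFree G c b := fun b => by
    rw [← hs.inducedHom_ofFree, ← hs.inducedHom_unique (NonUnitalStarAlgHom.id ℂ _) fun _ _ _ => rfl]
    rfl
  have hcont : Continuous ht.inducedHom :=
    AddMonoidHomClass.continuous_of_bound ht.inducedHom 1 fun a => by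
      rw [one_mul]; exact NonUnitalStarAlgHom.norm_apply_le ht.inducedHom a
  have hle : ∀ a, ‖a‖ ≤ ‖ht.inducedHom a‖ := by
    intro a
    refine (denseRange_ofFree G c).induction_on a
      (isClosed_le continuous_norm (continuous_norm.comp hcont)) fun b => ?_
    obtain ⟨M, hM⟩ := hs.exists_freeLift_mem_boundedSpan hrow b
    rw [hext] at hM
    exact hs.norm_le_norm_map_of_mem_boundedSpan ht hrow ht.inducedHom
      (fun _ _ f => ht.inducedHom_univFamily f) hv U hU hM
  refine (injective_iff_map_eq_zero ht.inducedHom).2 fun a ha => ?_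
  have := hle a
  rwa [ha, norm_zero, norm_le_zero_iff] at this

end uniqueness

/-! ### The twisted left regular representation on paths -/

section ltwo

/-- The Hilbert space of square-summable functions on a set. -/
abbrev LTwo (ι : Type w) : Type w := lp (fun _ : ι => ℂ) 2

open Classical in
/-- The standard basis vectors. -/
noncomputable def basisVec {ι : Type w} (i : ι) : LTwo ι := lp.single 2 i 1

variable {ι : Type w}

theorem inner_basisVec (i : ι) (ξ : LTwo ι) : inner ℂ (basisVec i) ξ = ξ i := by
  classical
  rw [basisVec, lp.inner_single_left]
  simp

theorem orthonormal_basisVec : Orthonormal ℂ (basisVec : ι → LTwo ι) := by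
  classical
  rw [orthonormal_iff_ite]
  intro i j
  rw [inner_basisVec, basisVec, lp.single_apply, Pi.single_apply]

theorem norm_basisVec (i : ι) : ‖basisVec i‖ = 1 := orthonormal_basisVec.1 i

theorem ext_basisVec {F : Type*} [NormedAddCommGroup F] [NormedSpace ℂ F] {S T : LTwo ι →L[ℂ] F}
    (h : ∀ i, S (basisVec i) = T (basisVec i)) : S = T := by
  classical
  refine lp.ext_continuousLinearMap (by simp) fun i => ContinuousLinearMap.ext_ring ?_
  simpa [basisVec] using h i

end ltwo

/-! ### Cancellation from unique factorisation, and the operators on path space. -/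

variable {k : ℕ} {Λ : Type u} [Category.{v} Λ]

/-- The path `μν` as an element of `Mor Λ`. -/
def compMor {x y : Λ} (f : x ⟶ y) (p : Σ w : Λ, w ⟶ x) : Mor Λ := ⟨p.1, y, p.2 ≫ f⟩

/-- Left cancellation: both tails have the same degree, so uniqueness of factorisation identifies
them. -/
theorem KGraph.compMor_injective (G : KGraph k Λ) {x y : Λ} (f : x ⟶ y) :
    Function.Injective (compMor f) := by
  rintro ⟨w, g⟩ ⟨w', g'⟩ h
  obtain ⟨rfl, h⟩ := Sigma.mk.inj_iff.1 h
  have h : g ≫ f = g' ≫ f := eq_of_heq (Sigma.mk.inj_iff.1 (eq_of_heq h)).2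
  have hd : G.deg g = G.deg g' := by
    have := congrArg G.deg h
    rwa [G.deg_comp, G.deg_comp, add_right_inj] at this
  obtain ⟨p, -, hp⟩ := G.factorisation (g ≫ f) (G.deg f) (G.deg g) (G.deg_comp f g)
  have h1 := hp ⟨x, f, g⟩ ⟨rfl, rfl, rfl⟩
  have h2 := hp ⟨x, f, g'⟩ ⟨rfl, hd.symm, h.symm⟩
  have h3 := h1.trans h2.symm
  simp only [Sigma.mk.injEq, heq_eq_eq, Prod.mk.injEq, true_and] at h3
  rw [h3]

/-- A path has only one initial segment of a given degree. This makes the ranges of the operators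
for distinct paths of equal degree orthogonal. -/
theorem KGraph.eq_of_compMor_eq (G : KGraph k Λ) {x x' y : Λ} {f : x ⟶ y} {f' : x' ⟶ y}
    (hd : G.deg f = G.deg f') {p : Σ w : Λ, w ⟶ x} {p' : Σ w : Λ, w ⟶ x'}
    (h : compMor f p = compMor f' p') : (⟨x, f⟩ : Σ x : Λ, x ⟶ y) = ⟨x', f'⟩ := by
  obtain ⟨w, g⟩ := p
  obtain ⟨w', g'⟩ := p'
  obtain ⟨rfl, h⟩ := Sigma.mk.inj_iff.1 h
  have h : g ≫ f = g' ≫ f' := eq_of_heq (Sigma.mk.inj_iff.1 (eq_of_heq h)).2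
  have hd' : G.deg g = G.deg g' := by
    have := congrArg G.deg h
    rwa [G.deg_comp, G.deg_comp, hd, add_right_inj] at this
  obtain ⟨p, -, hp⟩ := G.factorisation (g ≫ f) (G.deg f) (G.deg g) (G.deg_comp f g)
  have h1 := hp ⟨x, f, g⟩ ⟨rfl, rfl, rfl⟩
  have h2 := hp ⟨x', f', g'⟩ ⟨hd.symm, hd'.symm, h.symm⟩
  have h3 := h1.trans h2.symm
  exact congrArg (fun q : Σ z : Λ, (z ⟶ y) × (w ⟶ z) => (⟨q.1, q.2.1⟩ : Σ x : Λ, x ⟶ y)) h3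

variable (G : KGraph k Λ) (c : TwoCocycle Λ)

theorem KGraph.orthonormal_smul_basisVec_compMor (G : KGraph k Λ) (c : TwoCocycle Λ) {x y : Λ} (f : x ⟶ y) :
    Orthonormal ℂ fun p : Σ w : Λ, w ⟶ x => (c.toFun f p.2 : ℂ) • basisVec (compMor f p) := by
  have h := orthonormal_basisVec.comp (compMor f) (G.compMor_injective f)
  refine ⟨fun p => by rw [norm_smul, Circle.norm_coe, norm_basisVec, one_mul], fun p q hpq => ?_⟩
  change inner ℂ ((c.toFun f p.2 : ℂ) • basisVec (compMor f p))
    ((c.toFun f q.2 : ℂ) • basisVec (compMor f q)) = 0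
  rw [inner_smul_left, inner_smul_right, show inner ℂ (basisVec (compMor f p)) (basisVec (compMor f q)) = 0 from h.2 hpq]
  simp

/-- The isometry `e_ν ↦ c(f, ν) e_{fν}` from `ℓ²(s(f)Λ)` to `ℓ²(Λ)`. -/
noncomputable def pathIsometry {x y : Λ} (f : x ⟶ y) :
    LTwo (Σ w : Λ, w ⟶ x) →ₗᵢ[ℂ] LTwo (Mor Λ) :=
  (G.orthonormal_smul_basisVec_compMor c f).orthogonalFamily.linearIsometry

theorem pathIsometry_basisVec {x y : Λ} (f : x ⟶ y) (p : Σ w : Λ, w ⟶ x) :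
    pathIsometry G c f (basisVec p) = (c.toFun f p.2 : ℂ) • basisVec (compMor f p) := by
  classical
  rw [pathIsometry, basisVec, OrthogonalFamily.linearIsometry_apply_single]
  simp

/-- The isometry `pathIsometry`, as a continuous linear map. -/
noncomputable def pathCLM {x y : Λ} (f : x ⟶ y) : LTwo (Σ w : Λ, w ⟶ x) →L[ℂ] LTwo (Mor Λ) :=
  (pathIsometry G c f).toContinuousLinearMap

theorem pathCLM_basisVec {x y : Λ} (f : x ⟶ y) (p : Σ w : Λ, w ⟶ x) :
    pathCLM G c f (basisVec p) = (c.toFun f p.2 : ℂ) • basisVec (compMor f p) :=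
  pathIsometry_basisVec G c f p

theorem adjoint_pathCLM_pathCLM {x y : Λ} (f : x ⟶ y) (ξ : LTwo (Σ w : Λ, w ⟶ x)) :
    (pathCLM G c f).adjoint (pathCLM G c f ξ) = ξ :=
  DFunLike.congr_fun (LinearIsometry.adjoint_comp_self (pathIsometry G c f)) ξ

theorem adjoint_pathCLM_basisVec_compMor {x y : Λ} (f : x ⟶ y) (p : Σ w : Λ, w ⟶ x) :
    (pathCLM G c f).adjoint (basisVec (compMor f p)) =
      ((c.toFun f p.2)⁻¹ : Circle) • basisVec p := by
  have h := adjoint_pathCLM_pathCLM G c f (basisVec p)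
  rw [pathCLM_basisVec, map_smul] at h
  rw [eq_inv_smul_iff]
  exact h

theorem adjoint_pathCLM_basisVec_of_ne {x y : Λ} (f : x ⟶ y) {q : Mor Λ}
    (h : ∀ p, compMor f p ≠ q) : (pathCLM G c f).adjoint (basisVec q) = 0 := by
  ext p
  rw [← inner_basisVec, ContinuousLinearMap.adjoint_inner_right, pathCLM_basisVec, inner_smul_left,
    orthonormal_basisVec.2 (h p)]
  simp

/-- The twisted left regular representation on `ℓ²(Λ)`. -/
noncomputable def regRep ⦃x y : Λ⦄ (f : x ⟶ y) : LTwo (Mor Λ) →L[ℂ] LTwo (Mor Λ) :=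
  -- The adjoint of `pathCLM` at an identity restricts functions to the paths with range `x`.
  (pathCLM G c f).comp (pathCLM G c (𝟙 x)).adjoint

theorem compMor_id {x : Λ} (p : Σ w : Λ, w ⟶ x) : compMor (𝟙 x) p = ⟨p.1, x, p.2⟩ := by
  simp [compMor]

theorem regRep_basisVec {w x y : Λ} (f : x ⟶ y) (g : w ⟶ x) :
    regRep G c f (basisVec ⟨w, x, g⟩) = (c.toFun f g : ℂ) • basisVec ⟨w, y, g ≫ f⟩ := by
  have h := adjoint_pathCLM_basisVec_compMor G c (𝟙 x) ⟨w, g⟩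
  rw [compMor_id, c.map_id_left, inv_one, one_smul] at h
  rw [regRep, ContinuousLinearMap.comp_apply, h, pathCLM_basisVec]
  rfl

theorem regRep_basisVec_of_ne {x y : Λ} (f : x ⟶ y) {q : Mor Λ} (h : q.2.1 ≠ x) :
    regRep G c f (basisVec q) = 0 := by
  rw [regRep, ContinuousLinearMap.comp_apply, adjoint_pathCLM_basisVec_of_ne, map_zero]
  rintro p rfl
  exact h rfl

theorem star_regRep {x y : Λ} (f : x ⟶ y) :
    star (regRep G c f) = (pathCLM G c (𝟙 x)).comp (pathCLM G c f).adjoint := by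
  rw [ContinuousLinearMap.star_eq_adjoint, regRep, ContinuousLinearMap.adjoint_comp,
    ContinuousLinearMap.adjoint_adjoint]

theorem star_regRep_basisVec {w x y : Λ} (f : x ⟶ y) (g : w ⟶ x) :
    star (regRep G c f) (basisVec ⟨w, y, g ≫ f⟩) =
      ((c.toFun f g)⁻¹ : Circle) • basisVec ⟨w, x, g⟩ := by
  have h := adjoint_pathCLM_basisVec_compMor G c f ⟨w, g⟩
  rw [star_regRep, ContinuousLinearMap.comp_apply]
  change pathCLM G c (𝟙 x) ((pathCLM G c f).adjoint (basisVec (compMor f ⟨w, g⟩))) = _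
  rw [h, Circle.smul_def, map_smul, pathCLM_basisVec, compMor_id, c.map_id_left]
  simp [Circle.smul_def]

theorem star_regRep_basisVec_of_ne {x y : Λ} (f : x ⟶ y) {q : Mor Λ}
    (h : ∀ p, compMor f p ≠ q) : star (regRep G c f) (basisVec q) = 0 := by
  rw [star_regRep, ContinuousLinearMap.comp_apply, adjoint_pathCLM_basisVec_of_ne G c f h, map_zero]

theorem star_regRep_mul_regRep {x y : Λ} (f : x ⟶ y) :
    star (regRep G c f) * regRep G c f = regRep G c (𝟙 x) := by
  ext1 ξ
  rw [star_regRep]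
  simp only [mul_apply_eq_comp, regRep, ContinuousLinearMap.comp_apply,
    adjoint_pathCLM_pathCLM]

theorem star_regRep_id (x : Λ) : star (regRep G c (𝟙 x)) = regRep G c (𝟙 x) := star_regRep G c (𝟙 x)

theorem regRep_id_mul_of_ne {x y : Λ} (h : x ≠ y) : regRep G c (𝟙 x) * regRep G c (𝟙 y) = 0 := by
  refine ext_basisVec fun q => ?_
  obtain ⟨w, y', g⟩ := q
  rw [mul_apply_eq_comp]
  by_cases hy : y' = y
  · subst hy
    rw [regRep_basisVec, map_smul, regRep_basisVec_of_ne G c _ h.symm]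
    simp
  · rw [regRep_basisVec_of_ne G c _ hy]
    simp

/-- On the basis vector of a path `g` with range `s(ν)`, this is the cocycle identity for `(μ, ν,
g)`. -/
theorem regRep_mul_regRep {x y z : Λ} (μ : y ⟶ z) (ν : x ⟶ y) :
    regRep G c μ * regRep G c ν = (c.toFun μ ν : ℂ) • regRep G c (ν ≫ μ) := by
  refine ext_basisVec fun q => ?_
  obtain ⟨w, y', g⟩ := q
  rw [mul_apply_eq_comp, smul_apply]
  by_cases hy : y' = x
  · subst hy
    rw [regRep_basisVec, map_smul, regRep_basisVec, regRep_basisVec, smul_smul, smul_smul,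
      ← Circle.coe_mul, ← Circle.coe_mul, c.cocycle, Category.assoc]
  · rw [regRep_basisVec_of_ne G c _ hy, regRep_basisVec_of_ne G c _ hy]
    simp

/-- The relation (CK4) holds on paths of sufficiently large degree. -/
theorem regRep_ck4 (y : Λ) (n : Fin k → ℕ) (F : Finset (Σ x : Λ, x ⟶ y))
    (hF : (F : Set (Σ x : Λ, x ⟶ y)) = G.pathsInto y n) {q : Mor Λ} (hq : n ≤ G.deg q.2.2) :
    regRep G c (𝟙 y) (basisVec q) =
      (∑ p ∈ F, regRep G c p.2 * star (regRep G c p.2)) (basisVec q) := by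
  rw [sum_apply]
  have hmem : ∀ p, p ∈ F ↔ G.deg p.2 = n := fun p => by
    rw [← Finset.mem_coe, hF]; rfl
  obtain ⟨w, y', h⟩ := q
  by_cases hy : y' = y
  · subst hy
    obtain ⟨⟨z, l₁, l₂⟩, ⟨h1, -, h3⟩, -⟩ :=
      G.factorisation h n (G.deg h - n) (add_tsub_cancel_of_le hq).symm
    simp only at h1 h3
    subst h3
    -- Only the initial segment of degree `n` contributes, and the two cocycle factors cancel.
    rw [Finset.sum_eq_single_of_mem ⟨z, l₁⟩ ((hmem _).2 h1)]
    · rw [mul_apply_eq_comp, star_regRep_basisVec, Circle.smul_def, map_smul,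
        regRep_basisVec, regRep_basisVec, smul_smul, ← Circle.coe_mul, c.map_id_left,
        inv_mul_cancel, Category.comp_id]
    · rintro ⟨x, p⟩ hp hne
      rw [mul_apply_eq_comp, star_regRep_basisVec_of_ne, map_zero]
      intro r hr
      exact hne (G.eq_of_compMor_eq (((hmem _).1 hp).trans h1.symm) (p' := ⟨w, l₂⟩) hr)
  · rw [regRep_basisVec_of_ne G c _ hy, Finset.sum_eq_zero]
    intro p _
    rw [mul_apply_eq_comp, star_regRep_basisVec_of_ne, map_zero]
    rintro r hr
    exact hy (congrArg (fun q : Mor Λ => q.2.1) hr).symm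

/-! ### The seminorm at infinity of the left regular representation -/

/-- The closed span of the basis vectors of paths of degree at least `N`. -/
noncomputable def tailSpace (N : Fin k → ℕ) : Submodule ℂ (LTwo (Mor Λ)) :=
  (Submodule.span ℂ {ξ | ∃ q : Mor Λ, N ≤ G.deg q.2.2 ∧ basisVec q = ξ}).topologicalClosure

noncomputable instance (N : Fin k → ℕ) : CompleteSpace (tailSpace G N) :=
  Submodule.topologicalClosure.completeSpace _

variable {G}

theorem basisVec_mem_tailSpace {N : Fin k → ℕ} {q : Mor Λ} (h : N ≤ G.deg q.2.2) :
    basisVec q ∈ tailSpace G N :=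
  Submodule.le_topologicalClosure _ (Submodule.subset_span ⟨q, h, rfl⟩)

theorem map_mem_of_forall_basisVec {N : Fin k → ℕ} {K : Submodule ℂ (LTwo (Mor Λ))}
    (hK : IsClosed (K : Set (LTwo (Mor Λ)))) (T : LTwo (Mor Λ) →L[ℂ] LTwo (Mor Λ))
    (h : ∀ q : Mor Λ, N ≤ G.deg q.2.2 → T (basisVec q) ∈ K) :
    ∀ ξ ∈ tailSpace G N, T ξ ∈ K := by
  have : tailSpace G N ≤ K.comap T.toLinearMap := by
    refine Submodule.topologicalClosure_minimal _ (Submodule.span_le.2 ?_) (hK.preimage T.continuous)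
    rintro _ ⟨q, hq, rfl⟩
    exact h q hq
  exact fun ξ hξ => this hξ

theorem isClosed_tailSpace (N : Fin k → ℕ) : IsClosed (tailSpace G N : Set (LTwo (Mor Λ))) :=
  Submodule.isClosed_topologicalClosure _

theorem tailSpace_antitone : Antitone (tailSpace G) := fun N _ h ξ hξ =>
  map_mem_of_forall_basisVec (isClosed_tailSpace N) (ContinuousLinearMap.id ℂ _)
    (fun _ hq => basisVec_mem_tailSpace (h.trans hq)) ξ hξ

variable (G)

/-- Tail spaces need not be invariant, since adjoints shorten paths; but a fixed element shortens
them by a bounded amount. This gives the limit seminorm its submultiplicativity. -/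
theorem exists_freeLift_regRep_mem_tailSpace (a : FreeStar (Mor Λ)) (N : Fin k → ℕ) :
    ∃ M, ∀ ξ ∈ tailSpace G M, freeLift (regRep G c) a ξ ∈ tailSpace G N := by
  induction a using FreeStar.induction generalizing N with
  | h0 => exact ⟨N, fun ξ _ => by simp⟩
  | hadd a b ha hb =>
    obtain ⟨M, hM⟩ := ha N
    obtain ⟨M', hM'⟩ := hb N
    refine ⟨M ⊔ M', fun ξ hξ => ?_⟩
    rw [map_add]
    exact add_mem (hM ξ (tailSpace_antitone le_sup_left hξ))
      (hM' ξ (tailSpace_antitone le_sup_right hξ))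
  | hm w z =>
    simp only [freeLift, FreeStar.lift_mono]
    suffices h : ∃ M, ∀ ξ ∈ tailSpace G M,
        FreeStar.wordLift (fun p : Mor Λ => regRep G c p.2.2) w ξ ∈ tailSpace G N by
      obtain ⟨M, h⟩ := h
      exact ⟨M, fun ξ hξ => Submodule.smul_mem _ _ (h ξ hξ)⟩
    induction w using FreeSemigroup.recOnMul generalizing N with
    | ih1 q =>
      obtain ⟨⟨x, y, f⟩, b⟩ := q
      cases b
      · refine ⟨N, map_mem_of_forall_basisVec (isClosed_tailSpace N) _ ?_⟩
        rintro ⟨w, x', g⟩ hq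
        change regRep G c f _ ∈ _
        by_cases hx : x' = x
        · subst hx
          rw [regRep_basisVec]
          refine Submodule.smul_mem _ _ (basisVec_mem_tailSpace ?_)
          simp only [G.deg_comp]
          exact hq.trans le_add_self
        · rw [regRep_basisVec_of_ne G c _ hx]
          exact zero_mem _
      -- Removing an initial segment `f` lowers the degree by `d(f)`, so this much room is reserved.
      · refine ⟨G.deg f + N, map_mem_of_forall_basisVec (isClosed_tailSpace N) _ ?_⟩
        intro q hq
        change star (regRep G c f) _ ∈ _
        by_cases h : ∃ p, compMor f p = q
        · obtain ⟨⟨w, g⟩, rfl⟩ := h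
          simp only [compMor] at hq ⊢
          rw [star_regRep_basisVec, Circle.smul_def]
          refine Submodule.smul_mem _ _ (basisVec_mem_tailSpace ?_)
          rw [G.deg_comp] at hq
          exact le_of_add_le_add_left hq
        · rw [star_regRep_basisVec_of_ne G c f fun p hp => h ⟨p, hp⟩]
          exact zero_mem _
    | ih2 q w hq hw =>
      obtain ⟨M, hM⟩ := hq N
      obtain ⟨M', hM'⟩ := hw M
      refine ⟨M', fun ξ hξ => ?_⟩
      rw [map_mul]
      exact hM _ (hM' ξ hξ)

/-- The norm of the restriction of an element of the free `*`-algebra to `tailSpace G N`. -/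
noncomputable def tailNorm (a : FreeStar (Mor Λ)) (N : Fin k → ℕ) : ℝ :=
  ‖freeLift (regRep G c) a * (tailSpace G N).starProjection‖

theorem tailNorm_nonneg (a : FreeStar (Mor Λ)) (N : Fin k → ℕ) : 0 ≤ tailNorm G c a N :=
  norm_nonneg _

theorem tailNorm_antitone (a : FreeStar (Mor Λ)) : Antitone (tailNorm G c a) := by
  intro N M h
  have : (tailSpace G M).starProjection =
      (tailSpace G N).starProjection * (tailSpace G M).starProjection := by
    ext1 ξ
    exact (Submodule.starProjection_eq_self_iff.2
      (tailSpace_antitone h (Submodule.starProjection_apply_mem _ ξ))).symm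
  rw [tailNorm, this, ← mul_assoc]
  exact (norm_mul_le _ _).trans
    (mul_le_of_le_one_right (norm_nonneg _) (Submodule.starProjection_norm_le _))

theorem bddBelow_range_tailNorm (a : FreeStar (Mor Λ)) : BddBelow (Set.range (tailNorm G c a)) :=
  ⟨0, by rintro _ ⟨N, rfl⟩; exact tailNorm_nonneg G c a N⟩

theorem tailNorm_add_le (a b : FreeStar (Mor Λ)) (N : Fin k → ℕ) :
    tailNorm G c (a + b) N ≤ tailNorm G c a N + tailNorm G c b N := by
  rw [tailNorm, map_add, add_mul]
  exact norm_add_le _ _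

theorem tailNorm_smul (z : ℂ) (a : FreeStar (Mor Λ)) (N : Fin k → ℕ) :
    tailNorm G c (z • a) N = ‖z‖ * tailNorm G c a N := by
  rw [tailNorm, map_smul, smul_mul_assoc, norm_smul, tailNorm]

/-- Once `b` maps the smaller tail into `tailSpace G N`, the projection onto the latter can be
inserted between the factors. -/
theorem exists_tailNorm_mul_le (a b : FreeStar (Mor Λ)) (N : Fin k → ℕ) :
    ∃ M, ∀ M' ≥ M, tailNorm G c (a * b) M' ≤ tailNorm G c a N * tailNorm G c b M' := by
  obtain ⟨M, hM⟩ := exists_freeLift_regRep_mem_tailSpace G c b N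
  refine ⟨M, fun M' hM' => ?_⟩
  have : freeLift (regRep G c) (a * b) * (tailSpace G M').starProjection =
      (freeLift (regRep G c) a * (tailSpace G N).starProjection) *
        (freeLift (regRep G c) b * (tailSpace G M').starProjection) := by
    ext1 ξ
    simp only [map_mul, mul_apply_eq_comp]
    rw [Submodule.starProjection_eq_self_iff.2
      (hM _ (tailSpace_antitone hM' (Submodule.starProjection_apply_mem _ ξ)))]
  rw [tailNorm, this]
  exact norm_mul_le _ _

theorem tailNorm_mul_self_le (a : FreeStar (Mor Λ)) (N : Fin k → ℕ) :
    tailNorm G c a N * tailNorm G c a N ≤ tailNorm G c (star a * a) N := by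
  have hP : star (tailSpace G N).starProjection = (tailSpace G N).starProjection :=
    (isSelfAdjoint_starProjection _).star_eq
  rw [tailNorm, ← CStarRing.norm_star_mul_self, star_mul, hP, tailNorm, map_mul, map_star, mul_assoc,
    ← mul_assoc (star (freeLift (regRep G c) a))]
  exact (norm_mul_le _ _).trans
    (mul_le_of_le_one_left (norm_nonneg _) (Submodule.starProjection_norm_le _))

theorem tailNorm_eq_zero {a : FreeStar (Mor Λ)} {N : Fin k → ℕ}
    (h : ∀ q : Mor Λ, N ≤ G.deg q.2.2 → freeLift (regRep G c) a (basisVec q) = 0) :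
    tailNorm G c a N = 0 := by
  rw [tailNorm, norm_eq_zero]
  ext1 ξ
  have := map_mem_of_forall_basisVec (K := ⊥) (by simp)
    (freeLift (regRep G c) a) (fun q hq => (Submodule.mem_bot ℂ).2 (h q hq)) _
    (Submodule.starProjection_apply_mem (tailSpace G N) ξ)
  exact (Submodule.mem_bot ℂ).1 this

/-- The limit of the norms of the restrictions to `tailSpace G N`. -/
noncomputable def tailSeminorm : Seminorm ℂ (FreeStar (Mor Λ)) :=
  Seminorm.of (fun a => ⨅ N, tailNorm G c a N)
    (fun a b => le_ciInf_add_ciInf fun N M =>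
      (ciInf_le (bddBelow_range_tailNorm G c _) (N ⊔ M)).trans
        ((tailNorm_add_le G c a b _).trans
          (add_le_add (tailNorm_antitone G c a le_sup_left) (tailNorm_antitone G c b le_sup_right))))
    (fun z a => by simp_rw [tailNorm_smul]; exact (Real.mul_iInf_of_nonneg (norm_nonneg z) _).symm)

theorem tendsto_tailNorm (a : FreeStar (Mor Λ)) :
    Filter.Tendsto (tailNorm G c a) Filter.atTop (nhds (tailSeminorm G c a)) :=
  tendsto_atTop_ciInf (tailNorm_antitone G c a) (bddBelow_range_tailNorm G c a)

/-- For fixed `N`, first let the tail on which `b` acts recede; then let `N` grow. -/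
theorem tailSeminorm_mul_le (a b : FreeStar (Mor Λ)) :
    tailSeminorm G c (a * b) ≤ tailSeminorm G c a * tailSeminorm G c b := by
  refine ge_of_tendsto' ((tendsto_tailNorm G c a).mul_const _) fun N => ?_
  obtain ⟨M, hM⟩ := exists_tailNorm_mul_le G c a b N
  exact le_of_tendsto_of_tendsto (tendsto_tailNorm G c _)
    ((tendsto_tailNorm G c b).const_mul _) (Filter.eventually_atTop.2 ⟨M, hM⟩)

theorem tailSeminorm_mul_self_le (a : FreeStar (Mor Λ)) :
    tailSeminorm G c a * tailSeminorm G c a ≤ tailSeminorm G c (star a * a) :=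
  le_of_tendsto_of_tendsto' ((tendsto_tailNorm G c a).mul (tendsto_tailNorm G c a))
    (tendsto_tailNorm G c _) fun N => tailNorm_mul_self_le G c a N

theorem tailSeminorm_le_star (a : FreeStar (Mor Λ)) :
    tailSeminorm G c a ≤ tailSeminorm G c (star a) := by
  rcases (apply_nonneg (tailSeminorm G c) a).eq_or_lt' with h | h
  · rw [h]; exact apply_nonneg _ _
  · exact le_of_mul_le_mul_right
      ((tailSeminorm_mul_self_le G c a).trans (tailSeminorm_mul_le G c _ _)) h

/-- The seminorm ignores what happens outside any one tail, so a relation need only hold on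
sufficiently long paths. -/
theorem tailSeminorm_eq_zero {a : FreeStar (Mor Λ)} {N : Fin k → ℕ}
    (h : ∀ q : Mor Λ, N ≤ G.deg q.2.2 → freeLift (regRep G c) a (basisVec q) = 0) :
    tailSeminorm G c a = 0 :=
  le_antisymm ((ciInf_le (bddBelow_range_tailNorm G c a) N).trans_eq (tailNorm_eq_zero G c h))
    (apply_nonneg _ _)

theorem isCKSeminorm_tailSeminorm : IsCKSeminorm G c (tailSeminorm G c) where
  mul_le := tailSeminorm_mul_le G c
  star_mul_self a := by
    refine le_antisymm ((tailSeminorm_mul_le G c _ _).trans ?_) (tailSeminorm_mul_self_le G c a)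
    have := tailSeminorm_le_star G c (star a)
    rw [star_star] at this
    exact mul_le_mul_of_nonneg_right this (apply_nonneg _ _)
  rel a b h := by
    have key : ∀ {a b}, freeLift (regRep G c) a = freeLift (regRep G c) b →
        tailSeminorm G c (a - b) = 0 := fun h =>
      tailSeminorm_eq_zero G c (N := 0) fun q _ => by rw [map_sub, h, sub_self]; rfl
    cases h with
    | ck1_mul x =>
      refine key ?_
      have := star_regRep_mul_regRep G c (𝟙 x)
      rw [star_regRep_id] at this
      simpa only [map_mul, freeLift_gen] using this
    | ck1_star x => exact key (by simpa only [map_star, freeLift_gen] using star_regRep_id G c x)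
    | ck1_orth x y h =>
      exact key (by simpa only [map_mul, map_zero, freeLift_gen] using regRep_id_mul_of_ne G c h)
    | ck2 μ ν =>
      exact key (by simpa only [map_mul, map_smul, freeLift_gen] using regRep_mul_regRep G c μ ν)
    | ck3 f =>
      exact key (by
        simpa only [map_mul, map_star, freeLift_gen] using star_regRep_mul_regRep G c f)
    | ck4 y n F hF =>
      -- Here the limit is needed: paths of degree at least `n` have an initial segment of degree
      -- `n`, while shorter ones have none.
      refine tailSeminorm_eq_zero G c (N := n) fun q hq => ?_
      rw [map_sub, sub_apply, sub_eq_zero]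
      simpa only [map_sum, map_mul, map_star, freeLift_gen] using regRep_ck4 G c y n F hF hq

/-- Without sources, every tail contains a path with range `v`, and the operator at `v` fixes its
basis vector. -/
theorem one_le_tailSeminorm_gen_id (hsrc : G.NoSources) (v : Λ) :
    1 ≤ tailSeminorm G c (gen (𝟙 v)) := by
  refine le_ciInf fun N => ?_
  obtain ⟨⟨w, f⟩, hf⟩ := hsrc v N
  have hf : G.deg f = N := hf
  have h := (freeLift (regRep G c) (gen (𝟙 v)) * (tailSpace G N).starProjection).le_opNorm
    (basisVec ⟨w, v, f⟩)
  rw [mul_apply_eq_comp, Submodule.starProjection_eq_self_iff.2 (basisVec_mem_tailSpace hf.ge),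
    freeLift_gen, regRep_basisVec, norm_smul, Circle.norm_coe, norm_basisVec, norm_basisVec,
    mul_one, mul_one] at h
  rwa [tailNorm, freeLift_gen]

/-- The vertex projections of `C*(Λ, c)` are nonzero. -/
theorem univFamily_id_ne_zero (hsrc : G.NoSources) (v : Λ) : univFamily G c (𝟙 v) ≠ 0 := by
  rw [← norm_pos_iff, univFamily, norm_ofFree]
  exact zero_lt_one.trans_le ((one_le_tailSeminorm_gen_id G c hsrc v).trans
    (le_univSeminorm (isCKSeminorm_tailSeminorm G c) _))

end TwistedKGraph
-- The gauge-invariant uniqueness theorem.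
theorem mainTheorem5 {k : ℕ} {Λ : Type*} [CategoryTheory.Category Λ]
    (G : TwistedKGraph.KGraph k Λ) (hrow : G.RowFinite) (hsrc : G.NoSources)
    (c : TwistedKGraph.TwoCocycle Λ)
    {B : Type*} [NonUnitalCStarAlgebra B]
    (t : ∀ ⦃x y : Λ⦄, (x ⟶ y) → B) (ht : TwistedKGraph.IsCKFamily G c t)
    (β : (Fin k → Circle) →* (B ≃⋆ₐ[ℂ] B))
    (hβ_cont : ∀ b : B, Continuous fun z : Fin k → Circle => β z b)
    (hβ : ∀ (z : Fin k → Circle) ⦃x y : Λ⦄ (f : x ⟶ y),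
      β z (t f) = ((∏ i, z i ^ G.deg f i : Circle) : ℂ) • t f) :
    Function.Injective ht.inducedHom ↔ ∀ v : Λ, t (𝟙 v) ≠ 0 := by
  refine ⟨fun h v hv => TwistedKGraph.univFamily_id_ne_zero G c hsrc v (h ?_),
    fun h => ht.injective_inducedHom hrow h β hβ⟩
  rw [ht.inducedHom_univFamily, hv, map_zero]
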